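/- Let $n\ge 4$, let $G=S_n$, let $W=\mathbb{C}^n$ be the natural permutation representation of $S_n$ with standard basis $y_1,\dots,y_n$, let $x_1,\dots,x_n$ be the dual basis of $W^*$, and let $V=W^*\oplus W$, so that ${}^{\sigma}x_i=x_{\sigma(i)}$ and ${}^{\sigma}y_i=y_{\sigma(i)}$. Write $V^g=\{v\in V\mid {}^gv=v\}$. For $I\subseteq\{1,\dots,n\}$ put $x_I=\sum_{i\in I}x_i$, $x_I^\perp=\sum_{i\notin I}x_i$, and similarly $y_I,y_I^\perp$. A linear (respectively constant) $2$-cochain is a family $\kappa^L=\sum_{g\in G}\kappa^L_g\,g$ (respectively $\kappa^C=\sum_{g\in G}\kappa^C_g\,g$) of alternating bilinear maps $\kappa^L_g:V\times V\to V$ (respectively $\kappa^C_g:V\times V\to\mathbb{C}$). The sum $\kappa=\kappa^L+\kappa^C$ is a *Drinfeld orbifold algebra map* if for all $g\in G$ and $v_1,v_2,v_3\in V$, with $\mathrm{Alt}_3$ the alternating group on $\{1,2,3\}$: - $\operatorname{im}\kappa^L_g\subseteq V^g$; - $\kappa$ is $G$-invariant, i.e. ${}^h(\kappa^L_g(u,v))=\kappa^L_{hgh^{-1}}({}^hu,{}^hv)$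 and $\kappa^C_g(u,v)=\kappa^C_{hgh^{-1}}({}^hu,{}^hv)$ for all $h\in G$ and $u,v\in V$; - $\sum_{\sigma\in \mathrm{Alt}_3}\kappa^L_g(v_{\sigma(2)},v_{\sigma(3)})\,({}^gv_{\sigma(1)}-v_{\sigma(1)})=0$ in the symmetric algebra $S(V)$; - $\sum_{\sigma\in \mathrm{Alt}_3}\sum_{xy=g}\kappa^L_x\bigl(v_{\sigma(1)}+{}^yv_{\sigma(1)},\kappa^L_y(v_{\sigma(2)},v_{\sigma(3)})\bigr)=2\sum_{\sigma\in \mathrm{Alt}_3}\kappa^C_g(v_{\sigma(2)},v_{\sigma(3)})({}^gv_{\sigma(1)}-v_{\sigma(1)})$; - $\sum_{\sigma\in \mathrm{Alt}_3}\sum_{xy=g}\kappa^C_x\bigl(v_{\sigma(1)}+{}^yv_{\sigma(1)},\kappa^L_y(v_{\sigma(2)},v_{\sigma(3)})\bigr)=0$. For $a,a^\perp,b,b^\perp,c,\alpha,\beta\in\mathbb{C}$ define cochains by the following values on basis vectors (extended to be alternating and bilinear). - $\kappa^L_{\mathrm{refl}}$ and $\kappa^C_{\mathrm{refl}}$ have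 zero component at every $g$ that is not a transposition. If $g$ is a transposition, then $V^g$ lies in the kernel of both components at $g$, both vanish on all pairs $(x_i,x_j)$ and $(y_i,y_j)$, and for $i$ moved by $g$, $$\kappa^L_g(x_i,y_i)=-\kappa^L_g(x_i,y_{g(i)})=a\,x_{\{i,g(i)\}}+a^\perp x_{\{i,g(i)\}}^\perp+b\,y_{\{i,g(i)\}}+b^\perp y_{\{i,g(i)\}}^\perp,$$ $$\kappa^C_g(x_i,y_i)=-\kappa^C_g(x_i,y_{g(i)})=c.$$ - $\kappa^C_{\mathrm{tri}}$ has zero component at every $g$ that is not a $3$-cycle. If $g$ is a $3$-cycle, then $V^g$ lies in the kernel of $\kappa^C_g$, and for $i$ moved by $g$: $\kappa^C_g(x_i,y_i)=0$, $\kappa^C_g(x_i,x_{g(i)})=(b^\perp-b)^2$, $\kappa^C_g(y_i,y_{g(i)})=(a^\perp-a)^2$, and $\kappa^C_g(x_{g(i)},y_i)=-\kappa^C_g(x_i,y_{g(i)})=(a^\perp-a)(b^\perp-b)$. - $\kappa^C_1$ has zero component at every $g\ne1$, and its component at $1$ takes the values $(x_i,x_j)\mapsto0$, $(y_i,y_j)\mapsto0$,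 $(x_i,y_i)\mapsto\alpha$, and $(x_i,y_j)\mapsto\beta$ for $i\neq j$. Then the Drinfeld orbifold algebra maps $\kappa=\kappa^L+\kappa^C$ whose linear part is supported only off the identity (that is, $\kappa^L_1=0$ for the component at the identity $1\in S_n$) are precisely the maps of the form $$\kappa=\kappa^L_{\mathrm{refl}}+\kappa^C_{\mathrm{tri}}+\kappa^C_{\mathrm{refl}}+\kappa^C_1$$ with parameters $a,a^\perp,b,b^\perp,c,\alpha,\beta\in\mathbb{C}$ satisfying $$\alpha a+\beta(a+(n-2)a^\perp)=0,\qquad \alpha a^\perp+\beta(2a+(n-3)a^\perp)=0,$$ $$\alpha b+\beta(b+(n-2)b^\perp)=0,\qquad \alpha b^\perp+\beta(2b+(n-3)b^\perp)=0.$$ In particular, $\kappa=\kappa^L_{\mathrm{refl}}+\kappa^C_{\mathrm{tri}}+\kappa^C_{\mathrm{refl}}$ is a Drinfeld orbifold algebra map for all $a,a^\perp,b,b^\perp,c\in\mathbb{C}$. -/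

import Mathlib

namespace DrinfeldOrbifold

noncomputable section

/-- A `2`-cochain `α = ∑ g, α_g g` with values in `M`: a family, indexed by the group, of alternating
bilinear maps `α_g : V × V → M`. It is linear for `M = V` and constant for `M = ℂ`. -/
abbrev TwoCochain (G V M : Type*) [AddCommGroup V] [Module ℂ V] [AddCommGroup M] [Module ℂ M] :=
  G → V [⋀^Fin 2]→ₗ[ℂ] M

section General

variable {G V M : Type*} [Group G] [AddCommGroup V] [Module ℂ V] [AddCommGroup M] [Module ℂ M]

/-- `α` is supported only off `X`: the component `α_g` vanishes for all `g ∈ X`. -/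
def SupportedOnlyOff (α : TwoCochain G V M) (X : Set G) : Prop :=
  ∀ g ∈ X, α g = 0

/-- `G`-invariance, `ʰ(α_g) = α_{hgh⁻¹}` with `(ʰα_g)(v, w) = ʰ(α_g(ʰ⁻¹v, ʰ⁻¹w))`, where `G` acts
on `V` by `ρ` and on the values by `τ`. -/
def IsInvariant (ρ : Representation ℂ G V) (τ : Representation ℂ G M)
    (α : TwoCochain G V M) : Prop :=
  ∀ (g h : G) (v w : V),
    τ h (α g ![ρ h⁻¹ v, ρ h⁻¹ w]) = α (h * g * h⁻¹) ![v, w]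

/-- Sum of `f (v_{σ 1}) (v_{σ 2}) (v_{σ 3})` over `σ` in the alternating group on three letters. -/
def altSum {A : Type*} [AddCommGroup A] (f : V → V → V → A) (v₁ v₂ v₃ : V) : A :=
  f v₁ v₂ v₃ + f v₂ v₃ v₁ + f v₃ v₁ v₂

/-- `κ = κL + κC` is a Drinfeld orbifold algebra map for the action `ρ` of the finite group `G`.
A sum over all pairs `(x, y)` with `x * y = g` is written as a sum over `x` with `y = x⁻¹ * g`. -/
structure IsDrinfeldOrbifoldAlgebraMap [Fintype G] (ρ : Representation ℂ G V)
    (κL : TwoCochain G V V) (κC : TwoCochain G V ℂ) : Prop where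
  /-- The image of `κL_g` lies in the fixed space `V^g`. -/
  image_fixed : ∀ (g : G) (v w : V), ρ g (κL g ![v, w]) = κL g ![v, w]
  /-- The linear part is `G`-invariant. -/
  invariant_linear : IsInvariant ρ ρ κL
  /-- The constant part is `G`-invariant. -/
  invariant_constant : IsInvariant ρ (Representation.trivial ℂ G ℂ) κC
  /-- The mixed Jacobi identity, an identity in the symmetric algebra `S(V)`. -/
  mixed_jacobi : ∀ (g : G) (v₁ v₂ v₃ : V),
    altSum (fun u₁ u₂ u₃ =>
      SymmetricAlgebra.ι ℂ V (κL g ![u₂, u₃]) * SymmetricAlgebra.ι ℂ V (ρ g u₁ - u₁)) v₁ v₂ v₃ = 0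
  /-- The first obstruction vanishes. -/
  first_obstruction : ∀ (g : G) (v₁ v₂ v₃ : V),
    altSum (fun u₁ u₂ u₃ =>
      ∑ x : G, κL x ![u₁ + ρ (x⁻¹ * g) u₁, κL (x⁻¹ * g) ![u₂, u₃]]) v₁ v₂ v₃ =
    (2 : ℂ) • altSum (fun u₁ u₂ u₃ => κC g ![u₂, u₃] • (ρ g u₁ - u₁)) v₁ v₂ v₃
  /-- The second obstruction vanishes. -/
  second_obstruction : ∀ (g : G) (v₁ v₂ v₃ : V),
    altSum (fun u₁ u₂ u₃ =>
      ∑ x : G, κC x ![u₁ + ρ (x⁻¹ * g) u₁, κL (x⁻¹ * g) ![u₂, u₃]]) v₁ v₂ v₃ = 0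

/-- The alternating bilinear map whose value on a pair `(b p, b q)` of basis vectors is `K p q`. -/
def altOfTable {ι : Type*} [Fintype ι] (b : Module.Basis ι ℂ V) (K : ι → ι → M)
    (hK : ∀ p q, K p q = -K q p) : V [⋀^Fin 2]→ₗ[ℂ] M where
  toFun v := ∑ p, ∑ q, (b.repr (v 0) p * b.repr (v 1) q) • K p q
  map_update_add' := by
    intro inst m i x y
    obtain rfl : inst = instDecidableEqFin 2 := Subsingleton.elim _ _
    fin_cases i <;> simp [add_mul, mul_add, add_smul, Finset.sum_add_distrib]
  map_update_smul' := by
    intro inst m i c x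
    obtain rfl : inst = instDecidableEqFin 2 := Subsingleton.elim _ _
    fin_cases i <;> simp [Finset.smul_sum, smul_smul, mul_assoc, mul_left_comm]
  map_eq_zero_of_eq' := by
    intro v i j hv hij
    have h01 : v 0 = v 1 := by
      fin_cases i <;> fin_cases j <;> first | exact absurd rfl hij | exact hv | exact hv.symm
    show ∑ p, ∑ q, (b.repr (v 0) p * b.repr (v 1) q) • K p q = 0
    rw [h01]
    have h : ∑ p, ∑ q, (b.repr (v 1) p * b.repr (v 1) q) • K p q =
        -∑ p, ∑ q, (b.repr (v 1) p * b.repr (v 1) q) • K p q := by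
      conv_lhs => rw [Finset.sum_comm]
      simp only [← Finset.sum_neg_distrib]
      refine Finset.sum_congr rfl fun p _ => Finset.sum_congr rfl fun q _ => ?_
      rw [hK q p, smul_neg, mul_comm]
    have h2 := eq_neg_iff_add_eq_zero.mp h
    rw [← two_smul ℂ] at h2
    exact (smul_eq_zero.mp h2).resolve_left two_ne_zero

end General

/-- The natural permutation representation `W = ℂⁿ` of `S_n`, with `ᵟ(y_i) = y_{σ i}`. -/
def permRep (n : ℕ) : Representation ℂ (Equiv.Perm (Fin n)) (Fin n → ℂ) where
  toFun σ := LinearMap.funLeft ℂ ℂ (σ⁻¹ : Equiv.Perm (Fin n))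
  map_one' := by ext; simp
  map_mul' σ τ := by ext; simp [LinearMap.funLeft_apply]

/-- The space `V = W* ⊕ W`. -/
abbrev DoubledSpace (n : ℕ) := Module.Dual ℂ (Fin n → ℂ) × (Fin n → ℂ)

/-- The doubled permutation representation of `S_n` on `W* ⊕ W`. -/
def doubledPermRep (n : ℕ) : Representation ℂ (Equiv.Perm (Fin n)) (DoubledSpace n) :=
  (permRep n).dual.prod (permRep n)

/-- The basis `x_1, …, x_n, y_1, …, y_n` of `W* ⊕ W`: `x_i` is indexed by `Sum.inl i` and `y_i` by
`Sum.inr i`; `y_i` is the standard basis of `W` and `x_i` the dual basis of `W*`. -/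
def xyBasis (n : ℕ) : Module.Basis (Fin n ⊕ Fin n) ℂ (DoubledSpace n) :=
  (Pi.basisFun ℂ (Fin n)).dualBasis.prod (Pi.basisFun ℂ (Fin n))

/-- `x_I = ∑ i ∈ I, x_i`. -/
def xSum {n : ℕ} (I : Finset (Fin n)) : DoubledSpace n := ∑ i ∈ I, xyBasis n (Sum.inl i)

/-- `y_I = ∑ i ∈ I, y_i`. -/
def ySum {n : ℕ} (I : Finset (Fin n)) : DoubledSpace n := ∑ i ∈ I, xyBasis n (Sum.inr i)

section Tables

variable {n : ℕ} {M : Type*} [AddCommGroup M]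

/-- For a transposition `g` and `i` moved by `g`, the pair `(x_i, y_i)` has the value `u` and the pair
`(x_i, y_{g i})` the value `-u`; all other pairs `(x_i, y_j)` and all pairs `(x_i, x_j)` and
`(y_i, y_j)` have the value `0`. -/
def reflTable (g : Equiv.Perm (Fin n)) (u : M) : Fin n ⊕ Fin n → Fin n ⊕ Fin n → M
  | Sum.inl i, Sum.inr j => if g i = i then 0 else if j = i then u else if j = g i then -u else 0
  | Sum.inr j, Sum.inl i =>
      -(if g i = i then 0 else if j = i then u else if j = g i then -u else 0)
  | Sum.inl _, Sum.inl _ => 0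
  | Sum.inr _, Sum.inr _ => 0

theorem reflTable_skew (g : Equiv.Perm (Fin n)) (u : M) (p q : Fin n ⊕ Fin n) :
    reflTable g u p q = -reflTable g u q p := by
  rcases p with i | i <;> rcases q with j | j <;> simp [reflTable]

/-- For a `3`-cycle `g`: `1` if `j = g i`, `-1` if `i = g j`, and `0` otherwise. -/
def cycleSign (g : Equiv.Perm (Fin n)) (i j : Fin n) : ℂ :=
  (if j = g i then 1 else 0) - (if i = g j then 1 else 0)

/-- For a `3`-cycle `g`, with `A = a^⊥ - a` and `B = b^⊥ - b`: the value on `(x_i, x_{g i})` is `B ^ 2`,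
on `(y_i, y_{g i})` it is `A ^ 2`, and on `(x_{g i}, y_i)` and `(y_{g i}, x_i)` it is `A * B`. -/
def triTable (g : Equiv.Perm (Fin n)) (A B : ℂ) : Fin n ⊕ Fin n → Fin n ⊕ Fin n → ℂ
  | Sum.inl i, Sum.inl j => B ^ 2 * cycleSign g i j
  | Sum.inr i, Sum.inr j => A ^ 2 * cycleSign g i j
  | Sum.inl i, Sum.inr j => -(A * B * cycleSign g i j)
  | Sum.inr i, Sum.inl j => -(A * B * cycleSign g i j)

theorem triTable_skew (g : Equiv.Perm (Fin n)) (A B : ℂ) (p q : Fin n ⊕ Fin n) :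
    triTable g A B p q = -triTable g A B q p := by
  rcases p with i | i <;> rcases q with j | j <;> simp only [triTable, cycleSign] <;> ring

/-- The pair `(x_i, y_i)` has the value `α`, the pair `(x_i, y_j)` with `i ≠ j` the value `β`, and the
pairs `(x_i, x_j)` and `(y_i, y_j)` the value `0`. -/
def oneTable (α β : ℂ) : Fin n ⊕ Fin n → Fin n ⊕ Fin n → ℂ
  | Sum.inl i, Sum.inr j => if i = j then α else β
  | Sum.inr j, Sum.inl i => -(if i = j then α else β)
  | Sum.inl _, Sum.inl _ => 0
  | Sum.inr _, Sum.inr _ => 0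

theorem oneTable_skew (α β : ℂ) (p q : Fin n ⊕ Fin n) :
    oneTable α β p q = -oneTable α β q p := by
  rcases p with i | i <;> rcases q with j | j <;> simp [oneTable]

end Tables

open Classical in
/-- The linear cochain `κ^L_refl`, supported only on transpositions. For a transposition `g`, the set
`g.support` is `{i, g i}` for either index `i` moved by `g`. -/
def kappaReflL (n : ℕ) (a a' b b' : ℂ) :
    TwoCochain (Equiv.Perm (Fin n)) (DoubledSpace n) (DoubledSpace n) := fun g =>
  if g.IsSwap then
    altOfTable (xyBasis n)
      (reflTable g (a • xSum g.support + a' • xSum g.supportᶜ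
        + b • ySum g.support + b' • ySum g.supportᶜ))
      (reflTable_skew g _)
  else 0

open Classical in
/-- The constant cochain `κ^C_refl`, supported only on transpositions. -/
def kappaReflC (n : ℕ) (c : ℂ) : TwoCochain (Equiv.Perm (Fin n)) (DoubledSpace n) ℂ := fun g =>
  if g.IsSwap then altOfTable (xyBasis n) (reflTable g c) (reflTable_skew g c) else 0

open Classical in
/-- The constant cochain `κ^C_tri`, supported only on `3`-cycles. -/
def kappaTriC (n : ℕ) (a a' b b' : ℂ) :
    TwoCochain (Equiv.Perm (Fin n)) (DoubledSpace n) ℂ := fun g =>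
  if g.IsThreeCycle then
    altOfTable (xyBasis n) (triTable g (a' - a) (b' - b)) (triTable_skew g _ _)
  else 0

/-- The constant cochain `κ^C_1`, supported only on the identity. -/
def kappaOneC (n : ℕ) (α β : ℂ) : TwoCochain (Equiv.Perm (Fin n)) (DoubledSpace n) ℂ := fun g =>
  if g = 1 then altOfTable (xyBasis n) (oneTable α β) (oneTable_skew α β) else 0

end

end DrinfeldOrbifold

/-! Images in `V^g` together with the mixed Jacobi identity make every coordinate of `κL g` a scalar
cocycle in the sense of `IsHomogeneous` (`isHomogeneous_coord`). In the doubled representation, each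
index moved by `g` gives two moved directions, `x` and `y`. A nonzero cocycle at `g ≠ 1` can exist
only when `g` is a transposition, and there it is a multiple of `reflForm` (`IsHomogeneous.eq_zero`,
`IsHomogeneous.eq_reflForm`). Invariance then leaves four parameters for a linear part vanishing at
the identity (`eq_kappaReflL`).

The first obstruction involves products of two transpositions. A product that is not a `3`-cycle
contributes nothing. A `3`-cycle has three factorizations, whose total is the boundary of `κ^C_tri`
(`first_obstruction_refl`). The remaining freedom in `κC` is therefore an invariant scalar cocycle:
a constant `c` on transpositions, and an invariant form at the identity with two parameters
(`eq_constant_part`).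

In the second obstruction, `κ^C_tri` and `κ^C_refl` contribute zero (`kappaTriC_term_eq_zero`,
`second_obstruction_refl`). What remains is the pairing of `κ^C_1` with the values of `κ^L_refl`.
Its coefficients are the left sides of the four equations (`kappaOneC_reflVec`), and vectors fixed
by a transposition isolate each of them. -/

namespace DrinfeldOrbifold

noncomputable section

/-! ### Coordinates on `W* ⊕ W` and the action on them -/

section Coordinates

variable {n : ℕ}

/-- The coordinate of a vector at `x_i`. -/
def cx (i : Fin n) : DoubledSpace n →ₗ[ℂ] ℂ := (xyBasis n).coord (Sum.inl i)

/-- The coordinate of a vector at `y_i`. -/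
def cy (i : Fin n) : DoubledSpace n →ₗ[ℂ] ℂ := (xyBasis n).coord (Sum.inr i)

theorem repr_inl (v : DoubledSpace n) (i : Fin n) : (xyBasis n).repr v (Sum.inl i) = cx i v := rfl

theorem repr_inr (v : DoubledSpace n) (i : Fin n) : (xyBasis n).repr v (Sum.inr i) = cy i v := rfl

@[simp] theorem cx_x (i j : Fin n) : cx i (xyBasis n (Sum.inl j)) = if j = i then 1 else 0 := by
  simp [cx, Finsupp.single_apply]

@[simp] theorem cx_y (i j : Fin n) : cx i (xyBasis n (Sum.inr j)) = 0 := by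
  simp [cx]

@[simp] theorem cy_x (i j : Fin n) : cy i (xyBasis n (Sum.inl j)) = 0 := by
  simp [cy]

@[simp] theorem cy_y (i j : Fin n) : cy i (xyBasis n (Sum.inr j)) = if j = i then 1 else 0 := by
  simp [cy, Finsupp.single_apply]

theorem ext_coord {v w : DoubledSpace n} (hx : ∀ i, cx i v = cx i w) (hy : ∀ i, cy i v = cy i w) :
    v = w := by
  refine (xyBasis n).repr.injective (Finsupp.ext ?_)
  rintro (i | i)
  · exact hx i
  · exact hy i

theorem cx_eq (i : Fin n) (v : DoubledSpace n) : cx i v = v.1 (Pi.single i 1) := by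
  simp [cx, xyBasis]

theorem cy_eq (i : Fin n) (v : DoubledSpace n) : cy i v = v.2 i := by
  simp [cy, xyBasis]

@[simp] theorem cx_rep (g : Equiv.Perm (Fin n)) (i : Fin n) (v : DoubledSpace n) :
    cx i (doubledPermRep n g v) = cx (g⁻¹ i) v := by
  rw [cx_eq, cx_eq]
  simp only [doubledPermRep, Representation.prod_apply_apply, Representation.dual_apply,
    Module.Dual.transpose_apply]
  change v.1 _ = v.1 _
  congr 1
  ext j
  simp [permRep, LinearMap.funLeft_apply, Pi.single_apply, Equiv.eq_symm_apply]
  rfl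

@[simp] theorem cy_rep (g : Equiv.Perm (Fin n)) (i : Fin n) (v : DoubledSpace n) :
    cy i (doubledPermRep n g v) = cy (g⁻¹ i) v := by
  rw [cy_eq, cy_eq]
  rfl

theorem rep_x (g : Equiv.Perm (Fin n)) (i : Fin n) :
    doubledPermRep n g (xyBasis n (Sum.inl i)) = xyBasis n (Sum.inl (g i)) := by
  refine ext_coord (fun j => ?_) (fun j => ?_) <;> simp [Equiv.eq_symm_apply]

theorem rep_y (g : Equiv.Perm (Fin n)) (i : Fin n) :
    doubledPermRep n g (xyBasis n (Sum.inr i)) = xyBasis n (Sum.inr (g i)) := by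
  refine ext_coord (fun j => ?_) (fun j => ?_) <;> simp [Equiv.eq_symm_apply]

end Coordinates

/-! ### Alternating bilinear maps and tables of values -/

section Alternating

variable {V M : Type*} [AddCommGroup V] [Module ℂ V] [AddCommGroup M] [Module ℂ M]

theorem alt_swap (c : V [⋀^Fin 2]→ₗ[ℂ] M) (v w : V) : c ![v, w] = -c ![w, v] := by
  have h := c.map_swap ![w, v] (i := 0) (j := 1) (by decide)
  rw [← h]
  congr 1
  ext k
  fin_cases k <;> simp

theorem alt_ext {c d : V [⋀^Fin 2]→ₗ[ℂ] M} (h : ∀ v w, c ![v, w] = d ![v, w]) : c = d := by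
  ext v
  have hv : v = ![v 0, v 1] := by ext k; fin_cases k <;> rfl
  rw [hv]
  exact h _ _

theorem altOfTable_apply {ι : Type*} [Fintype ι] (b : Module.Basis ι ℂ V) (K : ι → ι → M)
    (hK : ∀ p q, K p q = -K q p) (v w : V) :
    altOfTable b K hK ![v, w] = ∑ p, ∑ q, (b.repr v p * b.repr w q) • K p q := rfl

theorem eq_altOfTable {ι : Type*} [Fintype ι] (b : Module.Basis ι ℂ V) (K : ι → ι → M)
    (hK : ∀ p q, K p q = -K q p) (c : V [⋀^Fin 2]→ₗ[ℂ] M)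
    (h : ∀ p q, c ![b p, b q] = K p q) : c = altOfTable b K hK := by
  classical
  refine Module.Basis.ext_alternating b fun v _ => ?_
  have hv : (fun i => b (v i)) = ![b (v 0), b (v 1)] := by ext k; fin_cases k <;> rfl
  rw [hv, h, altOfTable_apply]
  simp [Finsupp.single_apply]

end Alternating

/-! ### Closed formulas for the forms given by tables -/

section TableFormulas

variable {n : ℕ} {M : Type*} [AddCommGroup M] [Module ℂ M]

/-- The alternating form `(x_i - x_j)^* ∧ (y_i - y_j)^*` attached to a transposition. -/
def reflForm (i j : Fin n) (v w : DoubledSpace n) : ℂ :=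
  (cx i v - cx j v) * (cy i w - cy j w) - (cy i v - cy j v) * (cx i w - cx j w)

theorem altOfTable_reflTable {i j : Fin n} (hij : i ≠ j) (u : M) (v w : DoubledSpace n) :
    altOfTable (xyBasis n) (reflTable (Equiv.swap i j) u) (reflTable_skew _ u) ![v, w] =
      reflForm i j v w • u := by
  -- The table has rank one: it is the product of `δ_i - δ_j` in `p` and `δ_i - δ_j` in `q`, so the
  -- double sum factors.
  have key : ∀ p q : Fin n, (if Equiv.swap i j p = p then (0 : M) else if q = p then u
      else if q = Equiv.swap i j p then -u else 0) =
      (((if p = i then 1 else 0) - (if p = j then 1 else 0) : ℂ) *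
        ((if q = i then 1 else 0) - (if q = j then 1 else 0) : ℂ)) • u := by
    intro p q
    by_cases hpi : p = i
    · subst hpi
      by_cases hq : q = p
      · subst hq; simp [hij, hij.symm]
      · by_cases hq' : q = j <;> simp [hij, hij.symm, hq, hq']
    · by_cases hpj : p = j
      · subst hpj
        by_cases hq : q = p
        · subst hq; simp [hij, hij.symm]
        · by_cases hq' : q = i <;> simp [hij, hij.symm, hq, hq']
      · simp [Equiv.swap_apply_of_ne_of_ne hpi hpj, hpi, hpj]
  have sum1 : ∀ f : Fin n → ℂ, ∑ p, f p * ((if p = i then 1 else 0) - (if p = j then 1 else 0)) =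
      f i - f j := by
    intro f; simp [mul_sub]
  have fact : ∀ f h : Fin n → ℂ, ∑ p, ∑ q, (f p * h q) •
      ((((if p = i then 1 else 0) - (if p = j then 1 else 0) : ℂ) *
        ((if q = i then 1 else 0) - (if q = j then 1 else 0) : ℂ)) • u) =
      ((f i - f j) * (h i - h j)) • u := by
    intro f h
    rw [← sum1 f, ← sum1 h, Finset.sum_mul_sum, Finset.sum_smul]
    refine Finset.sum_congr rfl fun p _ => ?_
    rw [Finset.sum_smul]
    refine Finset.sum_congr rfl fun q _ => ?_
    rw [smul_smul]; congr 1; ring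
  rw [altOfTable_apply]
  simp only [Fintype.sum_sum_type, reflTable, repr_inl, repr_inr, key, smul_zero,
    Finset.sum_const_zero, zero_add, add_zero, smul_neg, Finset.sum_neg_distrib]
  rw [fact (fun p => cx p v) (fun p => cy p w)]
  rw [Finset.sum_comm]
  have := fact (fun p => cx p w) (fun p => cy p v)
  simp only [mul_comm (cx _ w)] at this
  rw [this, ← sub_eq_add_neg, ← sub_smul, reflForm]
  congr 1; ring

/-- The functional `(a^⊥ - a) y_p^* - (b^⊥ - b) x_p^*`. -/
def ell (A B : ℂ) (p : Fin n) (v : DoubledSpace n) : ℂ := A * cy p v - B * cx p v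

/-- The coefficients `B ^ 2`, `A ^ 2`, `-(A * B)` are those of a product of two functionals `ell`,
so all four blocks combine into a sum of wedges `ell_p ∧ ell_{g p}`. -/
theorem altOfTable_triTable (g : Equiv.Perm (Fin n)) (A B : ℂ) (v w : DoubledSpace n) :
    altOfTable (xyBasis n) (triTable g A B) (triTable_skew g A B) ![v, w] =
      ∑ p, (ell A B p v * ell A B (g p) w - ell A B p w * ell A B (g p) v) := by
  have fact : ∀ f h : Fin n → ℂ, ∑ p, ∑ q, f p * h q * cycleSign g p q =
      ∑ p, (f p * h (g p) - f (g p) * h p) := by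
    intro f h
    simp only [cycleSign, mul_sub, Finset.sum_sub_distrib]
    congr 1
    · simp
    · rw [Finset.sum_comm]; simp
  have fact' : ∀ (f h : Fin n → ℂ) (t : ℂ), ∑ p, ∑ q, f p * h q * (t * cycleSign g p q) =
      t * ∑ p, (f p * h (g p) - f (g p) * h p) := by
    intro f h t
    rw [← fact, Finset.mul_sum]
    refine Finset.sum_congr rfl fun p _ => ?_
    rw [Finset.mul_sum]
    exact Finset.sum_congr rfl fun q _ => by ring
  rw [altOfTable_apply]
  simp only [Fintype.sum_sum_type, triTable, repr_inl, repr_inr, smul_eq_mul,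
    Finset.sum_add_distrib, mul_neg, Finset.sum_neg_distrib]
  rw [fact' (fun p => cx p v) (fun p => cx p w), fact' (fun p => cy p v) (fun p => cy p w),
    fact' (fun p => cx p v) (fun p => cy p w), fact' (fun p => cy p v) (fun p => cx p w)]
  simp only [Finset.mul_sum, ← Finset.sum_add_distrib, ← Finset.sum_neg_distrib]
  refine Finset.sum_congr rfl fun p _ => ?_
  simp only [ell]
  ring

theorem altOfTable_oneTable (α β : ℂ) (v w : DoubledSpace n) :
    altOfTable (xyBasis n) (oneTable α β) (oneTable_skew α β) ![v, w] =
      (α - β) * ∑ p, (cx p v * cy p w - cy p v * cx p w) +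
        β * ((∑ p, cx p v) * (∑ p, cy p w) - (∑ p, cy p v) * (∑ p, cx p w)) := by
  have fact : ∀ f h : Fin n → ℂ, ∑ p, ∑ q, f p * h q * (if p = q then α else β) =
      (α - β) * ∑ p, f p * h p + β * ((∑ p, f p) * (∑ p, h p)) := by
    intro f h
    have : ∀ p q : Fin n, f p * h q * (if p = q then α else β) =
        (if p = q then (α - β) * (f p * h q) else 0) + β * (f p * h q) := by
      intro p q; split_ifs <;> ring
    simp only [this, Finset.sum_add_distrib]
    rw [Finset.sum_mul_sum]
    simp [Finset.mul_sum]
  rw [altOfTable_apply]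
  simp only [Fintype.sum_sum_type, oneTable, repr_inl, repr_inr, smul_eq_mul, mul_zero,
    Finset.sum_const_zero, zero_add, add_zero, mul_neg, Finset.sum_neg_distrib]
  rw [fact (fun p => cx p v) (fun p => cy p w), Finset.sum_comm]
  have := fact (fun p => cx p w) (fun p => cy p v)
  simp only [mul_comm (cx _ w)] at this
  rw [this, Finset.sum_sub_distrib]
  ring

end TableFormulas

/-! ### Scalar cocycles at a group element -/

section Homogeneous

variable {n : ℕ}

/-- The two-cocycle condition on the component at `g` of a constant cochain. -/
def IsHomogeneous (g : Equiv.Perm (Fin n)) (c : DoubledSpace n [⋀^Fin 2]→ₗ[ℂ] ℂ) : Prop :=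
  ∀ v₁ v₂ v₃, altSum (fun u₁ u₂ u₃ => c ![u₂, u₃] • (doubledPermRep n g u₁ - u₁)) v₁ v₂ v₃ = 0

variable {g : Equiv.Perm (Fin n)} {c : DoubledSpace n [⋀^Fin 2]→ₗ[ℂ] ℂ}

theorem IsHomogeneous.cx_eq_zero (h : IsHomogeneous g c) (p : Fin n) (v₁ v₂ v₃ : DoubledSpace n) :
    c ![v₂, v₃] * (cx (g⁻¹ p) v₁ - cx p v₁) + c ![v₃, v₁] * (cx (g⁻¹ p) v₂ - cx p v₂) +
      c ![v₁, v₂] * (cx (g⁻¹ p) v₃ - cx p v₃) = 0 := by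
  simpa [altSum] using congrArg (cx p) (h v₁ v₂ v₃)

theorem IsHomogeneous.cy_eq_zero (h : IsHomogeneous g c) (p : Fin n) (v₁ v₂ v₃ : DoubledSpace n) :
    c ![v₂, v₃] * (cy (g⁻¹ p) v₁ - cy p v₁) + c ![v₃, v₁] * (cy (g⁻¹ p) v₂ - cy p v₂) +
      c ![v₁, v₂] * (cy (g⁻¹ p) v₃ - cy p v₃) = 0 := by
  simpa [altSum] using congrArg (cy p) (h v₁ v₂ v₃)

/-- Since `g` moves `i`, the `i`-th coordinate of `g v - v` is nonzero on `x_i` or `y_i`, so the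
cocycle identity can be solved for `c`. The `y`-coordinate gives `c` against `x_i`, the
`x`-coordinate gives `c` against `y_i`, and one more use of the `x`-coordinate gives all values. -/
theorem IsHomogeneous.eq_reflForm (h : IsHomogeneous g c) {i : Fin n} (hi : g i ≠ i)
    (v w : DoubledSpace n) :
    c ![v, w] = reflForm i (g⁻¹ i) v w * c ![xyBasis n (Sum.inl i), xyBasis n (Sum.inr i)] := by
  have hi' : i ≠ g⁻¹ i := fun e => hi (by rw [Equiv.Perm.eq_inv_iff_eq] at e; exact e)
  have hx : ∀ v, c ![v, xyBasis n (Sum.inl i)] = (cy (g⁻¹ i) v - cy i v) *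
      c ![xyBasis n (Sum.inl i), xyBasis n (Sum.inr i)] := by
    intro v
    have := h.cy_eq_zero i v (xyBasis n (Sum.inl i)) (xyBasis n (Sum.inr i))
    simp only [cy_x, cy_y, if_neg hi', if_true] at this
    linear_combination -this
  have hy : ∀ v, c ![xyBasis n (Sum.inr i), v] = (cx (g⁻¹ i) v - cx i v) *
      c ![xyBasis n (Sum.inl i), xyBasis n (Sum.inr i)] := by
    intro v
    have := h.cx_eq_zero i v (xyBasis n (Sum.inl i)) (xyBasis n (Sum.inr i))
    simp only [cx_x, cx_y, if_neg hi', if_true] at this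
    linear_combination -this
  have := h.cx_eq_zero i v w (xyBasis n (Sum.inl i))
  rw [hx w, alt_swap c _ v, hx v] at this
  simp only [cx_x, if_neg hi', if_true] at this
  rw [reflForm]
  linear_combination -this

/-- Such a `g` moves some `j` outside `{i, g i}`. The `x_j`-coordinate of the identity at `x_i, y_i,
x_j` reads `-c(x_i, y_i) = 0`, and this value determines `c`. -/
theorem IsHomogeneous.eq_zero (h : IsHomogeneous g c) (hg : g ≠ 1) (hs : ¬ g.IsSwap) : c = 0 := by
  obtain ⟨i, hi⟩ : ∃ i, g i ≠ i := by
    by_contra! hcon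
    exact hg (Equiv.ext hcon)
  obtain ⟨j, hj, hji, hjg⟩ : ∃ j, g j ≠ j ∧ j ≠ i ∧ j ≠ g i := by
    by_contra! hcon
    refine hs ⟨i, g i, hi.symm, ?_⟩
    have hgg : g (g i) = i := by
      by_contra hne
      exact hi (g.injective (hcon _ (fun e => hi (g.injective (g.injective e))) hne))
    ext k
    by_cases hk : g k = k
    · rw [hk, Equiv.swap_apply_of_ne_of_ne]
      · rintro rfl; exact hi hk
      · rintro rfl; exact hi (g.injective hk)
    · by_cases hki : k = i
      · subst hki; simp
      · rw [hcon k hk hki, hgg]; simp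
  have h0 : c ![xyBasis n (Sum.inl i), xyBasis n (Sum.inr i)] = 0 := by
    have := h.cx_eq_zero j (xyBasis n (Sum.inl i)) (xyBasis n (Sum.inr i)) (xyBasis n (Sum.inl j))
    have h1 : i ≠ g⁻¹ j := fun e => hjg (by rw [Equiv.Perm.eq_inv_iff_eq] at e; exact e.symm)
    have h2 : j ≠ g⁻¹ j := fun e => hj (by rw [Equiv.Perm.eq_inv_iff_eq] at e; exact e)
    simp only [cx_x, cx_y, if_neg h1, if_neg h2, if_neg hji.symm, if_true] at this
    linear_combination -this
  refine alt_ext fun v w => ?_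
  rw [h.eq_reflForm hi, h0]
  simp

theorem IsHomogeneous.eq_reflForm_swap {i j : Fin n} (h : IsHomogeneous (Equiv.swap i j) c)
    (hij : i ≠ j) (v w : DoubledSpace n) :
    c ![v, w] = reflForm i j v w * c ![xyBasis n (Sum.inl i), xyBasis n (Sum.inr i)] := by
  have := h.eq_reflForm (i := i) (by simpa using hij.symm) v w
  simpa using this

theorem rep_swap_sub (i j : Fin n) (v : DoubledSpace n) :
    doubledPermRep n (Equiv.swap i j) v - v =
      (cx i v - cx j v) • (xyBasis n (Sum.inl j) - xyBasis n (Sum.inl i)) +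
      (cy i v - cy j v) • (xyBasis n (Sum.inr j) - xyBasis n (Sum.inr i)) := by
  refine ext_coord (fun k => ?_) (fun k => ?_) <;>
  · by_cases hki : k = i
    · subst hki
      by_cases hkj : k = j
      · subst hkj; simp
      · simp [Ne.symm hkj]
    · by_cases hkj : k = j
      · subst hkj; simp [Ne.symm hki]
      · simp [Ne.symm hki, Ne.symm hkj, Equiv.swap_apply_of_ne_of_ne hki hkj]

/-- This is Cramer's relation among three vectors of the plane `V / V^g`: `reflForm` is the
determinant in the two coordinates through which `g - 1` factors. -/
theorem altSum_reflForm (i j : Fin n) (v₁ v₂ v₃ : DoubledSpace n) :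
    altSum (fun u₁ u₂ u₃ => reflForm i j u₂ u₃ •
      (doubledPermRep n (Equiv.swap i j) u₁ - u₁)) v₁ v₂ v₃ = 0 := by
  simp only [altSum, rep_swap_sub, reflForm]
  module

end Homogeneous

/-! ### From the mixed Jacobi identity to scalar cocycles -/

section MixedJacobi

variable {n : ℕ}

/-- A functional on `V` extends to a character of `S(V)`, turning the identity into a scalar one.
Averaging over powers of `g` separates the two factors of the product: one lies in `V^g`, the other
in the image of `g - 1`. -/
theorem isHomogeneous_coord {g : Equiv.Perm (Fin n)}
    {κ : DoubledSpace n [⋀^Fin 2]→ₗ[ℂ] DoubledSpace n}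
    (hfix : ∀ v w, doubledPermRep n g (κ ![v, w]) = κ ![v, w])
    (hmix : ∀ v₁ v₂ v₃, altSum (fun u₁ u₂ u₃ =>
      SymmetricAlgebra.ι ℂ (DoubledSpace n) (κ ![u₂, u₃]) *
        SymmetricAlgebra.ι ℂ (DoubledSpace n) (doubledPermRep n g u₁ - u₁)) v₁ v₂ v₃ = 0)
    (f : DoubledSpace n →ₗ[ℂ] ℂ) : IsHomogeneous g (f.compAlternatingMap κ) := by
  set ρ := doubledPermRep n
  have quad : ∀ (h : DoubledSpace n →ₗ[ℂ] ℂ) (v₁ v₂ v₃ : DoubledSpace n),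
      altSum (fun u₁ u₂ u₃ => h (κ ![u₂, u₃]) * h (ρ g u₁ - u₁)) v₁ v₂ v₃ = 0 := by
    intro h v₁ v₂ v₃
    have := congrArg (SymmetricAlgebra.lift h) (hmix v₁ v₂ v₃)
    simpa only [altSum, map_add, map_mul, SymmetricAlgebra.lift_ι_apply, map_zero] using this
  -- `F` kills the image of `g - 1` and equals `orderOf g * f` on `V^g`.
  set F : DoubledSpace n →ₗ[ℂ] ℂ := ∑ k ∈ Finset.range (orderOf g), f ∘ₗ ρ (g ^ k) with hF
  have hFD : ∀ v, F (ρ g v - v) = 0 := by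
    intro v
    have h1 : ∀ k, f (ρ (g ^ k) (ρ g v)) = f (ρ (g ^ (k + 1)) v) := by
      intro k; rw [pow_succ, map_mul]; rfl
    simp only [hF, LinearMap.sum_apply, LinearMap.comp_apply, map_sub, h1,
      ← Finset.sum_sub_distrib]
    rw [Finset.sum_range_sub (fun k => f (ρ (g ^ k) v)), pow_orderOf_eq_one]
    simp
  have hFκ : ∀ v w, F (κ ![v, w]) = orderOf g * f (κ ![v, w]) := by
    intro v w
    have h1 : ∀ k, ρ (g ^ k) (κ ![v, w]) = κ ![v, w] := by
      intro k
      induction k with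
      | zero => simp
      | succ k ih => rw [pow_succ, map_mul, Module.End.mul_apply, hfix, ih]
    simp only [hF, LinearMap.sum_apply, LinearMap.comp_apply, h1, Finset.sum_const,
      Finset.card_range, nsmul_eq_mul]
  have hord : (orderOf g : ℂ) ≠ 0 := by exact_mod_cast (orderOf_pos g).ne'
  intro v₁ v₂ v₃
  have hl : ∀ f' : DoubledSpace n →ₗ[ℂ] ℂ, f' (altSum (fun u₁ u₂ u₃ =>
      f.compAlternatingMap κ ![u₂, u₃] • (ρ g u₁ - u₁)) v₁ v₂ v₃) = 0 := by
    intro f'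
    -- Polarization: the difference of the identities for `F + f'` and `f'` leaves only `F` on the
    -- first factor times `f'` on the second.
    have h1 := quad (F + f') v₁ v₂ v₃
    have h2 := quad f' v₁ v₂ v₃
    simp only [altSum, LinearMap.add_apply, hFD, hFκ] at h1 h2
    refine (mul_eq_zero.mp ?_).resolve_left hord
    simp only [altSum, map_add, map_smul, smul_eq_mul, LinearMap.compAlternatingMap_apply]
    linear_combination h1 - h2
  exact ext_coord (fun i => by rw [hl, map_zero]) (fun i => by rw [hl, map_zero])

end MixedJacobi

/-! ### The explicit cochains -/

section Kappa

variable {n : ℕ}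

/-- The common value of `κ^L_refl` at the transposition `(i j)` on `(x_i, y_i)`. -/
def reflVec (a a' b b' : ℂ) (i j : Fin n) : DoubledSpace n :=
  a • xSum (Equiv.swap i j).support + a' • xSum (Equiv.swap i j).supportᶜ
    + b • ySum (Equiv.swap i j).support + b' • ySum (Equiv.swap i j).supportᶜ

theorem cx_xSum (p : Fin n) (I : Finset (Fin n)) : cx p (xSum I) = if p ∈ I then 1 else 0 := by
  simp [xSum]

theorem cx_ySum (p : Fin n) (I : Finset (Fin n)) : cx p (ySum I) = 0 := by
  simp [ySum]

theorem cy_xSum (p : Fin n) (I : Finset (Fin n)) : cy p (xSum I) = 0 := by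
  simp [xSum]

theorem cy_ySum (p : Fin n) (I : Finset (Fin n)) : cy p (ySum I) = if p ∈ I then 1 else 0 := by
  simp [ySum]

theorem mem_support_swap {i j : Fin n} (hij : i ≠ j) (p : Fin n) :
    p ∈ (Equiv.swap i j).support ↔ p = i ∨ p = j := by
  simp [Equiv.Perm.support_swap hij]

theorem cx_reflVec (a a' b b' : ℂ) {i j : Fin n} (hij : i ≠ j) (p : Fin n) :
    cx p (reflVec a a' b b' i j) = if p = i ∨ p = j then a else a' := by
  simp only [reflVec, map_add, map_smul, cx_xSum, cx_ySum, Finset.mem_compl,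
    mem_support_swap hij]
  split_ifs <;> simp_all

theorem cy_reflVec (a a' b b' : ℂ) {i j : Fin n} (hij : i ≠ j) (p : Fin n) :
    cy p (reflVec a a' b b' i j) = if p = i ∨ p = j then b else b' := by
  simp only [reflVec, map_add, map_smul, cy_xSum, cy_ySum, Finset.mem_compl,
    mem_support_swap hij]
  split_ifs <;> simp_all

theorem isSwap_swap {i j : Fin n} (hij : i ≠ j) : (Equiv.swap i j).IsSwap := ⟨i, j, hij, rfl⟩

theorem kappaReflL_swap (a a' b b' : ℂ) {i j : Fin n} (hij : i ≠ j) (v w : DoubledSpace n) :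
    kappaReflL n a a' b b' (Equiv.swap i j) ![v, w] =
      reflForm i j v w • reflVec a a' b b' i j := by
  rw [kappaReflL, if_pos (isSwap_swap hij), altOfTable_reflTable hij]
  rfl

theorem kappaReflL_of_not_isSwap (a a' b b' : ℂ) {g : Equiv.Perm (Fin n)} (hg : ¬ g.IsSwap) :
    kappaReflL n a a' b b' g = 0 := if_neg hg

theorem kappaReflC_swap (c : ℂ) {i j : Fin n} (hij : i ≠ j) (v w : DoubledSpace n) :
    kappaReflC n c (Equiv.swap i j) ![v, w] = reflForm i j v w * c := by
  rw [kappaReflC, if_pos (isSwap_swap hij), altOfTable_reflTable hij, smul_eq_mul]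

theorem kappaReflC_of_not_isSwap (c : ℂ) {g : Equiv.Perm (Fin n)} (hg : ¬ g.IsSwap) :
    kappaReflC n c g = 0 := if_neg hg

theorem kappaTriC_of_isThreeCycle (a a' b b' : ℂ) {g : Equiv.Perm (Fin n)} (hg : g.IsThreeCycle)
    (v w : DoubledSpace n) :
    kappaTriC n a a' b b' g ![v, w] = ∑ p, (ell (a' - a) (b' - b) p v * ell (a' - a) (b' - b) (g p) w
      - ell (a' - a) (b' - b) p w * ell (a' - a) (b' - b) (g p) v) := by
  rw [kappaTriC, if_pos hg, altOfTable_triTable]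

theorem kappaTriC_of_not_isThreeCycle (a a' b b' : ℂ) {g : Equiv.Perm (Fin n)}
    (hg : ¬ g.IsThreeCycle) : kappaTriC n a a' b b' g = 0 := if_neg hg

theorem kappaOneC_one (α β : ℂ) :
    kappaOneC n α β 1 = altOfTable (xyBasis n) (oneTable α β) (oneTable_skew α β) := if_pos rfl

theorem kappaOneC_of_ne_one (α β : ℂ) {g : Equiv.Perm (Fin n)} (hg : g ≠ 1) :
    kappaOneC n α β g = 0 := if_neg hg

end Kappa

/-! ### Products of two transpositions -/

section Products

variable {n : ℕ}

/-- `reflForm p q` sees only differences of the `p`- and `q`-coordinates. These vanish when `p` and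
`q` are both inside or both outside `{r, s}`. -/
theorem reflForm_reflVec_eq_zero (a a' b b' : ℂ) {p q r s : Fin n} (hrs : r ≠ s)
    (h : (p = r ∨ p = s) ↔ (q = r ∨ q = s)) (d : ℂ) (v : DoubledSpace n) :
    reflForm p q v (d • reflVec a a' b b' r s) = 0 := by
  simp only [reflForm, map_smul, cx_reflVec a a' b b' hrs, cy_reflVec a a' b b' hrs, h]
  ring

theorem isThreeCycle_of_overlap {p q r s : Fin n} (hpq : p ≠ q) (hrs : r ≠ s)
    (h : ¬ ((p = r ∨ p = s) ↔ (q = r ∨ q = s))) :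
    (Equiv.swap p q * Equiv.swap r s).IsThreeCycle := by
  by_cases h1 : p = r
  · subst h1
    exact Equiv.Perm.isThreeCycle_swap_mul_swap_same hpq hrs (by rintro rfl; simp at h)
  by_cases h2 : p = s
  · subst h2
    rw [Equiv.swap_comm r]
    exact Equiv.Perm.isThreeCycle_swap_mul_swap_same hpq hrs.symm (by rintro rfl; simp at h)
  by_cases h3 : q = r
  · subst h3
    rw [Equiv.swap_comm p]
    exact Equiv.Perm.isThreeCycle_swap_mul_swap_same hpq.symm hrs h2
  by_cases h4 : q = s
  · subst h4
    rw [Equiv.swap_comm p, Equiv.swap_comm r]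
    exact Equiv.Perm.isThreeCycle_swap_mul_swap_same hpq.symm hrs.symm h1
  · simp [h1, h2, h3, h4] at h

variable {M : Type*} [AddCommGroup M] [Module ℂ M]

/-- A cochain supported on transpositions whose component at `(p q)` is a multiple of `reflForm p q`. -/
structure IsReflType (κ : TwoCochain (Equiv.Perm (Fin n)) (DoubledSpace n) M)
    (m : Fin n → Fin n → M) : Prop where
  off : ∀ g, ¬ g.IsSwap → κ g = 0
  on : ∀ p q, p ≠ q → ∀ v w, κ (Equiv.swap p q) ![v, w] = reflForm p q v w • m p q

theorem isReflType_kappaReflL (a a' b b' : ℂ) :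
    IsReflType (kappaReflL n a a' b b') (reflVec a a' b b') :=
  ⟨fun _ => kappaReflL_of_not_isSwap a a' b b', fun _ _ h => kappaReflL_swap a a' b b' h⟩

theorem isReflType_kappaReflC (c : ℂ) : IsReflType (kappaReflC n c) (fun _ _ => c) :=
  ⟨fun _ => kappaReflC_of_not_isSwap c, fun _ _ h => kappaReflC_swap c h⟩

variable {κ : TwoCochain (Equiv.Perm (Fin n)) (DoubledSpace n) M} {m : Fin n → Fin n → M}

theorem alt_apply_zero_right (c : DoubledSpace n [⋀^Fin 2]→ₗ[ℂ] M) (v : DoubledSpace n) :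
    c ![v, 0] = 0 := c.map_coord_zero 1 rfl

theorem IsReflType.term_eq_zero (hκ : IsReflType κ m) (a a' b b' : ℂ) {g : Equiv.Perm (Fin n)}
    (hg : ¬ g.IsThreeCycle) (x : Equiv.Perm (Fin n)) (u v w : DoubledSpace n) :
    κ x ![u, kappaReflL n a a' b b' (x⁻¹ * g) ![v, w]] = 0 := by
  by_cases hx : x.IsSwap
  · by_cases hy : (x⁻¹ * g).IsSwap
    · obtain ⟨p, q, hpq, rfl⟩ := hx
      obtain ⟨r, s, hrs, hy⟩ := hy
      have hgg : g = Equiv.swap p q * Equiv.swap r s := by rw [← hy]; simp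
      rw [hy, kappaReflL_swap a a' b b' hrs, hκ.on p q hpq, reflForm_reflVec_eq_zero, zero_smul]
      · exact hrs
      · by_contra hov
        exact hg (hgg ▸ isThreeCycle_of_overlap hpq hrs hov)
    · rw [kappaReflL_of_not_isSwap _ _ _ _ hy]
      exact alt_apply_zero_right _ _
  · rw [hκ.off x hx]; rfl

theorem swap_mul_swap_rotate {i j k : Fin n} (hij : i ≠ j) (hik : i ≠ k) (hjk : j ≠ k) :
    Equiv.swap i k * Equiv.swap i j = Equiv.swap j i * Equiv.swap j k := by
  ext p
  simp only [Equiv.Perm.mul_apply, Equiv.swap_apply_def]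
  grind

theorem IsReflType.term_overlap (hκ : IsReflType κ m) (a a' b b' : ℂ) {i j k : Fin n}
    (hij : i ≠ j) (hik : i ≠ k) (hjk : j ≠ k) (u v w : DoubledSpace n) :
    κ (Equiv.swap i k) ![u + doubledPermRep n (Equiv.swap i j) u,
        kappaReflL n a a' b b' (Equiv.swap i j) ![v, w]] =
      ((ell (a' - a) (b' - b) i u + ell (a' - a) (b' - b) j u - 2 * ell (a' - a) (b' - b) k u) *
        reflForm i j v w) • m i k := by
  rw [hκ.on i k hik, kappaReflL_swap a a' b b' hij]
  congr 1
  rw [reflForm]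
  simp only [map_smul, cx_reflVec a a' b b' hij, cy_reflVec a a' b b' hij, hik.symm, hjk.symm,
    true_or, or_self, if_true, if_false, map_add, cx_rep, cy_rep, Equiv.swap_inv,
    Equiv.swap_apply_left, Equiv.swap_apply_of_ne_of_ne hik.symm hjk.symm, ell, smul_eq_mul]
  ring

/-- If `x` moved a point fixed by the `3`-cycle, the second factor would have to send that point
where `x` does. The two transpositions would then coincide and have product `1`. -/
theorem eq_of_swap_mul_swap_eq {i j k : Fin n} (hij : i ≠ j) (hik : i ≠ k) (hjk : j ≠ k)
    {x : Equiv.Perm (Fin n)} (hx : x.IsSwap)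
    (hy : (x⁻¹ * (Equiv.swap i k * Equiv.swap i j)).IsSwap) :
    x = Equiv.swap i k ∨ x = Equiv.swap j i ∨ x = Equiv.swap k j := by
  set g := Equiv.swap i k * Equiv.swap i j with hg
  have key : ∀ p q : Fin n, p ≠ q → x = Equiv.swap p q → p = i ∨ p = j ∨ p = k := by
    intro p q hpq hxpq
    by_contra! hcon
    obtain ⟨h1, h2, h3⟩ := hcon
    obtain ⟨r, s, hrs, hy⟩ := hy
    have hgp : g p = p := by
      rw [hg, Equiv.Perm.mul_apply, Equiv.swap_apply_of_ne_of_ne h1 h2,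
        Equiv.swap_apply_of_ne_of_ne h1 h3]
    have hyp : Equiv.swap r s p = q := by
      rw [← hy, Equiv.Perm.mul_apply, hgp, hxpq]; simp
    have hxy : x = Equiv.swap r s := by
      rw [hxpq]
      by_cases hpr : p = r
      · subst hpr; rw [← hyp]; simp
      · by_cases hps : p = s
        · subst hps; rw [← hyp]; simp [Equiv.swap_comm]
        · rw [Equiv.swap_apply_of_ne_of_ne hpr hps] at hyp
          exact absurd hyp hpq
    have hg1 : g = 1 := by
      have : g = x * Equiv.swap r s := by rw [← hy]; simp
      rw [this, hxy]; simp
    have hgi : g i = j := by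
      rw [hg, Equiv.Perm.mul_apply, Equiv.swap_apply_left,
        Equiv.swap_apply_of_ne_of_ne hij.symm hjk]
    rw [hg1] at hgi
    exact hij hgi
  obtain ⟨p, q, hpq, hxpq⟩ := hx
  have hp := key p q hpq hxpq
  have hq := key q p hpq.symm (by rw [hxpq, Equiv.swap_comm])
  rcases hp with rfl | rfl | rfl <;> rcases hq with rfl | rfl | rfl <;>
    first
    | exact absurd rfl hpq
    | (simp [hxpq, Equiv.swap_comm])

/-- Rotating `i, j, k` produces the three factorizations of the cycle, hence the three terms.
Leaving `m` general serves both obstructions at once. -/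
theorem IsReflType.sum_threeCycle (hκ : IsReflType κ m) (a a' b b' : ℂ) {i j k : Fin n}
    (hij : i ≠ j) (hik : i ≠ k) (hjk : j ≠ k) (u v w : DoubledSpace n) :
    ∑ x : Equiv.Perm (Fin n), κ x
      ![u + doubledPermRep n (x⁻¹ * (Equiv.swap i k * Equiv.swap i j)) u,
        kappaReflL n a a' b b' (x⁻¹ * (Equiv.swap i k * Equiv.swap i j)) ![v, w]] =
      ((ell (a' - a) (b' - b) i u + ell (a' - a) (b' - b) j u - 2 * ell (a' - a) (b' - b) k u) *
        reflForm i j v w) • m i k +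
      ((ell (a' - a) (b' - b) j u + ell (a' - a) (b' - b) k u - 2 * ell (a' - a) (b' - b) i u) *
        reflForm j k v w) • m j i +
      ((ell (a' - a) (b' - b) k u + ell (a' - a) (b' - b) i u - 2 * ell (a' - a) (b' - b) j u) *
        reflForm k i v w) • m k j := by
  have r1 := swap_mul_swap_rotate hij hik hjk
  have r2 := swap_mul_swap_rotate hjk hij.symm hik.symm
  set g := Equiv.swap i k * Equiv.swap i j with hg
  have e1 : (Equiv.swap i k)⁻¹ * g = Equiv.swap i j := by rw [hg]; simp
  have e2 : (Equiv.swap j i)⁻¹ * g = Equiv.swap j k := by rw [r1]; simp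
  have e3 : (Equiv.swap k j)⁻¹ * g = Equiv.swap k i := by rw [r1, r2]; simp
  have ne1 : Equiv.swap i k ≠ Equiv.swap j i := fun e => by
    have := congrArg (fun σ : Equiv.Perm (Fin n) => σ i) e
    simp at this
    exact hjk this.symm
  have ne2 : Equiv.swap i k ≠ Equiv.swap k j := fun e => by
    have := congrArg (fun σ : Equiv.Perm (Fin n) => σ k) e
    simp at this
    exact hij this
  have ne3 : Equiv.swap j i ≠ Equiv.swap k j := fun e => by
    have := congrArg (fun σ : Equiv.Perm (Fin n) => σ j) e
    simp at this
    exact hik this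
  rw [← Finset.sum_subset (Finset.subset_univ {Equiv.swap i k, Equiv.swap j i, Equiv.swap k j})]
  · rw [Finset.sum_insert (by simp [ne1, ne2]), Finset.sum_insert (by simpa using ne3),
      Finset.sum_singleton, e1, e2, e3, hκ.term_overlap a a' b b' hij hik hjk,
      hκ.term_overlap a a' b b' hjk hij.symm hik.symm,
      hκ.term_overlap a a' b b' hik.symm hjk.symm hij, add_assoc]
  · intro x _ hx
    by_cases hxs : x.IsSwap
    · by_cases hys : (x⁻¹ * g).IsSwap
      · exact absurd (by simpa using eq_of_swap_mul_swap_eq hij hik hjk hxs hys) hx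
      · rw [kappaReflL_of_not_isSwap _ _ _ _ hys]
        exact alt_apply_zero_right _ _
    · rw [hκ.off x hxs]; rfl

theorem exists_of_isThreeCycle {g : Equiv.Perm (Fin n)} (hg : g.IsThreeCycle) :
    ∃ i j k : Fin n, i ≠ j ∧ i ≠ k ∧ j ≠ k ∧ g = Equiv.swap i k * Equiv.swap i j := by
  obtain ⟨i, hi⟩ : g.support.Nonempty := by
    rw [← Finset.card_pos, hg.card_support]
    norm_num
  have h2 := hg.nodup_iff_mem_support.mpr hi
  simp only [List.nodup_cons, List.mem_cons, List.not_mem_nil, or_false, not_or] at h2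
  refine ⟨g i, g (g i), i, h2.2.1, fun e => h2.1.1 e.symm, fun e => h2.1.2 e.symm, ?_⟩
  rw [Equiv.swap_comm (g i) i]
  exact hg.eq_swap_mul_swap_iff_mem_support.mpr hi

end Products

/-! ### Evaluation of the two obstructions -/

section Obstructions

variable {n : ℕ}

theorem swap_mul_swap_apply {i j k : Fin n} (hij : i ≠ j) (hik : i ≠ k) (hjk : j ≠ k) :
    (Equiv.swap i k * Equiv.swap i j) i = j ∧ (Equiv.swap i k * Equiv.swap i j) j = k ∧
      (Equiv.swap i k * Equiv.swap i j) k = i ∧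
      ∀ p, p ≠ i → p ≠ j → p ≠ k → (Equiv.swap i k * Equiv.swap i j) p = p := by
  refine ⟨?_, ?_, ?_, fun p hi hj hk => ?_⟩
  · simp [Equiv.swap_apply_of_ne_of_ne hij.symm hjk]
  · simp
  · simp [Equiv.swap_apply_of_ne_of_ne hik.symm hjk.symm]
  · simp [Equiv.swap_apply_of_ne_of_ne hi hj, Equiv.swap_apply_of_ne_of_ne hi hk]

theorem isThreeCycle_swap_mul_swap {i j k : Fin n} (hij : i ≠ j) (hik : i ≠ k) (hjk : j ≠ k) :
    (Equiv.swap i k * Equiv.swap i j).IsThreeCycle :=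
  Equiv.Perm.isThreeCycle_swap_mul_swap_same hik hij hjk.symm

theorem kappaTriC_swap_mul_swap (a a' b b' : ℂ) {i j k : Fin n} (hij : i ≠ j) (hik : i ≠ k)
    (hjk : j ≠ k) (v w : DoubledSpace n) :
    kappaTriC n a a' b b' (Equiv.swap i k * Equiv.swap i j) ![v, w] =
      (ell (a' - a) (b' - b) i v * ell (a' - a) (b' - b) j w
        - ell (a' - a) (b' - b) i w * ell (a' - a) (b' - b) j v) +
      (ell (a' - a) (b' - b) j v * ell (a' - a) (b' - b) k w
        - ell (a' - a) (b' - b) j w * ell (a' - a) (b' - b) k v) +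
      (ell (a' - a) (b' - b) k v * ell (a' - a) (b' - b) i w
        - ell (a' - a) (b' - b) k w * ell (a' - a) (b' - b) i v) := by
  obtain ⟨hi, hj, hk, ho⟩ := swap_mul_swap_apply hij hik hjk
  rw [kappaTriC_of_isThreeCycle a a' b b' (isThreeCycle_swap_mul_swap hij hik hjk),
    ← Finset.sum_subset (Finset.subset_univ {i, j, k})]
  · rw [Finset.sum_insert (by simp [hij, hik]), Finset.sum_insert (by simpa using hjk),
      Finset.sum_singleton, hi, hj, hk, add_assoc]
  · intro p _ hp
    simp only [Finset.mem_insert, Finset.mem_singleton, not_or] at hp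
    rw [ho p hp.1 hp.2.1 hp.2.2]
    ring

theorem isHomogeneous_kappaReflC (c : ℂ) (g : Equiv.Perm (Fin n)) :
    IsHomogeneous g (kappaReflC n c g) := by
  intro v₁ v₂ v₃
  by_cases hg : g.IsSwap
  · obtain ⟨i, j, hij, rfl⟩ := hg
    have := congrArg (c • ·) (altSum_reflForm i j v₁ v₂ v₃)
    simp only [altSum, smul_add, smul_zero] at this
    simp only [altSum, kappaReflC_swap c hij]
    rw [← this]
    module
  · simp [altSum, kappaReflC_of_not_isSwap c hg]

theorem isHomogeneous_one (c : DoubledSpace n [⋀^Fin 2]→ₗ[ℂ] ℂ) : IsHomogeneous 1 c := by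
  intro v₁ v₂ v₃
  simp [altSum]

/-- This treats the case where the three weights `m` agree: coordinates outside the `3`-cycle in the
first obstruction, and the constant `c` in the second. -/
theorem altSum_overlap {A B : ℂ} {i j k : Fin n} (v₁ v₂ v₃ : DoubledSpace n) :
    altSum (fun u v w =>
      (ell A B i u + ell A B j u - 2 * ell A B k u) * reflForm i j v w +
      (ell A B j u + ell A B k u - 2 * ell A B i u) * reflForm j k v w +
      (ell A B k u + ell A B i u - 2 * ell A B j u) * reflForm k i v w) v₁ v₂ v₃ = 0 := by
  simp only [altSum, ell, reflForm]
  ring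

theorem first_obstruction_refl (a a' b b' : ℂ) (g : Equiv.Perm (Fin n))
    (v₁ v₂ v₃ : DoubledSpace n) :
    altSum (fun u₁ u₂ u₃ => ∑ x : Equiv.Perm (Fin n), kappaReflL n a a' b b' x
      ![u₁ + doubledPermRep n (x⁻¹ * g) u₁, kappaReflL n a a' b b' (x⁻¹ * g) ![u₂, u₃]]) v₁ v₂ v₃ =
    (2 : ℂ) • altSum (fun u₁ u₂ u₃ => kappaTriC n a a' b b' g ![u₂, u₃] •
      (doubledPermRep n g u₁ - u₁)) v₁ v₂ v₃ := by
  by_cases hg : g.IsThreeCycle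
  · obtain ⟨i, j, k, hij, hik, hjk, rfl⟩ := exists_of_isThreeCycle hg
    obtain ⟨hi, hj, hk, ho⟩ := swap_mul_swap_apply hij hik hjk
    simp only [(isReflType_kappaReflL a a' b b').sum_threeCycle a a' b b' hij hik hjk,
      kappaTriC_swap_mul_swap a a' b b' hij hik hjk]
    set g := Equiv.swap i k * Equiv.swap i j
    have hj' : g⁻¹ j = i := by rw [Equiv.Perm.inv_eq_iff_eq, hi]
    have hk' : g⁻¹ k = j := by rw [Equiv.Perm.inv_eq_iff_eq, hj]
    have hi' : g⁻¹ i = k := by rw [Equiv.Perm.inv_eq_iff_eq, hk]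
    have ho' : ∀ p, p ≠ i → p ≠ j → p ≠ k → g⁻¹ p = p := fun p h1 h2 h3 => by
      rw [Equiv.Perm.inv_eq_iff_eq, ho p h1 h2 h3]
    obtain ⟨A, rfl⟩ : ∃ A, a' = a + A := ⟨a' - a, by ring⟩
    obtain ⟨B, rfl⟩ : ∃ B, b' = b + B := ⟨b' - b, by ring⟩
    simp only [add_sub_cancel_left]
    have hC := altSum_overlap (A := A) (B := B) (i := i) (j := j) (k := k) v₁ v₂ v₃
    simp only [altSum] at hC ⊢
    refine ext_coord (fun p => ?_) (fun p => ?_)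
    all_goals
      simp only [map_add, map_smul, map_sub, smul_eq_mul, cx_rep, cy_rep,
        cx_reflVec _ _ _ _ hij.symm, cx_reflVec _ _ _ _ hik, cx_reflVec _ _ _ _ hjk.symm,
        cy_reflVec _ _ _ _ hij.symm, cy_reflVec _ _ _ _ hik, cy_reflVec _ _ _ _ hjk.symm]
      by_cases h1 : p = i
      · subst h1
        simp only [hij, hik, hi', true_or, or_true, or_self, if_true, if_false]
        simp only [ell, reflForm]
        ring
      by_cases h2 : p = j
      · subst h2
        simp only [h1, hjk, hj', true_or, or_true, or_self, if_true, if_false]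
        simp only [ell, reflForm]
        ring
      by_cases h3 : p = k
      · subst h3
        simp only [h1, h2, hk', true_or, or_true, or_self, if_true, if_false]
        simp only [ell, reflForm]
        ring
      -- Off the cycle the right side vanishes and the three vectors share the coordinate `a'` or
      -- `b'`, which factors out.
      simp only [h1, h2, h3, ho' p h1 h2 h3, or_self, if_false]
      first
      | linear_combination (a + A) * hC
      | linear_combination (b + B) * hC
  · simp only [(isReflType_kappaReflL a a' b b').term_eq_zero a a' b b' hg,
      kappaTriC_of_not_isThreeCycle _ _ _ _ hg]
    simp [altSum]

theorem second_obstruction_refl (a a' b b' c : ℂ) (g : Equiv.Perm (Fin n))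
    (v₁ v₂ v₃ : DoubledSpace n) :
    altSum (fun u₁ u₂ u₃ => ∑ x : Equiv.Perm (Fin n), kappaReflC n c x
      ![u₁ + doubledPermRep n (x⁻¹ * g) u₁, kappaReflL n a a' b b' (x⁻¹ * g) ![u₂, u₃]])
      v₁ v₂ v₃ = 0 := by
  by_cases hg : g.IsThreeCycle
  · obtain ⟨i, j, k, hij, hik, hjk, rfl⟩ := exists_of_isThreeCycle hg
    simp only [(isReflType_kappaReflC c).sum_threeCycle a a' b b' hij hik hjk]
    have hC := altSum_overlap (A := a' - a) (B := b' - b) (i := i) (j := j) (k := k) v₁ v₂ v₃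
    simp only [altSum, smul_eq_mul] at hC ⊢
    linear_combination c * hC
  · simp only [(isReflType_kappaReflC c).term_eq_zero a a' b b' hg]
    simp [altSum]

theorem ell_reflVec (a a' b b' : ℂ) {i j : Fin n} (hij : i ≠ j) (p : Fin n) :
    ell (a' - a) (b' - b) p (reflVec a a' b b' i j) = a' * b - a * b' := by
  rw [ell, cx_reflVec _ _ _ _ hij, cy_reflVec _ _ _ _ hij]
  split_ifs <;> ring

/-- By `ell_reflVec`, `ell_p` takes the same value on `reflVec` for every `p`, so the sum of wedges
telescopes along the permutation `x`. -/
theorem kappaTriC_term_eq_zero (a a' b b' : ℂ) (g x : Equiv.Perm (Fin n))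
    (u v w : DoubledSpace n) :
    kappaTriC n a a' b b' x ![u, kappaReflL n a a' b b' g ![v, w]] = 0 := by
  by_cases hx : x.IsThreeCycle
  · by_cases hg : g.IsSwap
    · obtain ⟨i, j, hij, rfl⟩ := hg
      have hl : ∀ (d : ℂ) (p : Fin n), ell (a' - a) (b' - b) p (d • reflVec a a' b b' i j) =
          d * (a' * b - a * b') := by
        intro d p
        rw [← ell_reflVec a a' b b' hij p]
        simp only [ell, map_smul, smul_eq_mul]
        ring
      rw [kappaTriC_of_isThreeCycle _ _ _ _ hx, kappaReflL_swap _ _ _ _ hij]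
      simp only [hl, Finset.sum_sub_distrib, ← Finset.mul_sum, ← Finset.sum_mul]
      rw [Equiv.sum_comp x (fun p => ell (a' - a) (b' - b) p u)]
      ring
    · rw [kappaReflL_of_not_isSwap _ _ _ _ hg]
      exact alt_apply_zero_right _ _
  · rw [kappaTriC_of_not_isThreeCycle _ _ _ _ hx]; rfl

theorem sum_ite_pair {i j : Fin n} (hij : i ≠ j) (s t : ℂ) :
    ∑ p, (if p = i ∨ p = j then s else t) = 2 * s + ((n : ℂ) - 2) * t := by
  have : ∀ p, (if p = i ∨ p = j then s else t) =
      (if p = i then s - t else 0) + (if p = j then s - t else 0) + t := by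
    intro p
    by_cases h1 : p = i
    · subst h1; simp [hij]
    · simp [h1]; split_ifs <;> ring
  simp only [this, Finset.sum_add_distrib, Finset.sum_ite_eq', Finset.mem_univ, if_true,
    Finset.sum_const, Finset.card_univ, Fintype.card_fin, nsmul_eq_mul]
  ring

/-- The pairing of `κ^C_1` with the value of `κ^L_refl` at a transposition. -/
theorem kappaOneC_reflVec (a a' b b' α β : ℂ) {i j : Fin n} (hij : i ≠ j) (v : DoubledSpace n) :
    kappaOneC n α β 1 ![v, reflVec a a' b b' i j] =
      (∑ p, cx p v * (if p = i ∨ p = j then α * b + β * (b + ((n : ℂ) - 2) * b')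
        else α * b' + β * (2 * b + ((n : ℂ) - 3) * b'))) -
      ∑ p, cy p v * (if p = i ∨ p = j then α * a + β * (a + ((n : ℂ) - 2) * a')
        else α * a' + β * (2 * a + ((n : ℂ) - 3) * a')) := by
  rw [kappaOneC_one, altOfTable_oneTable]
  simp only [cx_reflVec _ _ _ _ hij, cy_reflVec _ _ _ _ hij, sum_ite_pair hij]
  rw [Finset.sum_mul, Finset.sum_mul, ← Finset.sum_sub_distrib, ← Finset.sum_sub_distrib,
    Finset.mul_sum, Finset.mul_sum, ← Finset.sum_add_distrib]
  refine Finset.sum_congr rfl fun p _ => ?_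
  split_ifs <;> ring

theorem sum_kappaOneC (a a' b b' α β : ℂ) (g : Equiv.Perm (Fin n)) (u v w : DoubledSpace n) :
    ∑ x : Equiv.Perm (Fin n), kappaOneC n α β x
      ![u + doubledPermRep n (x⁻¹ * g) u, kappaReflL n a a' b b' (x⁻¹ * g) ![v, w]] =
    kappaOneC n α β 1 ![u + doubledPermRep n g u, kappaReflL n a a' b b' g ![v, w]] := by
  rw [Finset.sum_eq_single 1]
  · simp
  · intro x _ hx
    rw [kappaOneC_of_ne_one _ _ hx]; rfl
  · simp

theorem second_obstruction_add (a a' b b' c α β : ℂ) (g : Equiv.Perm (Fin n))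
    (v₁ v₂ v₃ : DoubledSpace n) :
    altSum (fun u₁ u₂ u₃ => ∑ x : Equiv.Perm (Fin n),
      (kappaTriC n a a' b b' + kappaReflC n c + kappaOneC n α β) x
      ![u₁ + doubledPermRep n (x⁻¹ * g) u₁, kappaReflL n a a' b b' (x⁻¹ * g) ![u₂, u₃]])
      v₁ v₂ v₃ =
    altSum (fun u₁ u₂ u₃ => kappaOneC n α β 1
      ![u₁ + doubledPermRep n g u₁, kappaReflL n a a' b b' g ![u₂, u₃]]) v₁ v₂ v₃ := by
  have h := second_obstruction_refl a a' b b' c g v₁ v₂ v₃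
  simp only [altSum, Pi.add_apply, AlternatingMap.add_apply, Finset.sum_add_distrib,
    kappaTriC_term_eq_zero, sum_kappaOneC, Finset.sum_const_zero] at h ⊢
  linear_combination h

end Obstructions

/-! ### Invariance under conjugation -/

section Invariance

variable {n : ℕ}

theorem isSwap_conj_iff (g h : Equiv.Perm (Fin n)) : (h * g * h⁻¹).IsSwap ↔ g.IsSwap := by
  rw [Equiv.Perm.isSwap_iff_cycleType, Equiv.Perm.isSwap_iff_cycleType,
    Equiv.Perm.cycleType_conj]

theorem isThreeCycle_conj_iff (g h : Equiv.Perm (Fin n)) :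
    (h * g * h⁻¹).IsThreeCycle ↔ g.IsThreeCycle := by
  rw [Equiv.Perm.IsThreeCycle, Equiv.Perm.IsThreeCycle, Equiv.Perm.cycleType_conj]

theorem conj_swap (h : Equiv.Perm (Fin n)) (i j : Fin n) :
    h * Equiv.swap i j * h⁻¹ = Equiv.swap (h i) (h j) := by
  rw [Equiv.mul_swap_eq_swap_mul, mul_inv_cancel_right]

theorem reflForm_rep_inv (h : Equiv.Perm (Fin n)) (i j : Fin n) (v w : DoubledSpace n) :
    reflForm i j (doubledPermRep n h⁻¹ v) (doubledPermRep n h⁻¹ w) =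
      reflForm (h i) (h j) v w := by
  simp only [reflForm, cx_rep, cy_rep, inv_inv]

theorem rep_reflVec (a a' b b' : ℂ) (h : Equiv.Perm (Fin n)) {i j : Fin n} (hij : i ≠ j) :
    doubledPermRep n h (reflVec a a' b b' i j) = reflVec a a' b b' (h i) (h j) := by
  have hij' : h i ≠ h j := h.injective.ne hij
  refine ext_coord (fun p => ?_) (fun p => ?_)
  · simp only [cx_rep, cx_reflVec _ _ _ _ hij, cx_reflVec _ _ _ _ hij', Equiv.Perm.inv_eq_iff_eq]
  · simp only [cy_rep, cy_reflVec _ _ _ _ hij, cy_reflVec _ _ _ _ hij', Equiv.Perm.inv_eq_iff_eq]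

theorem isInvariant_kappaReflL (a a' b b' : ℂ) :
    IsInvariant (doubledPermRep n) (doubledPermRep n) (kappaReflL n a a' b b') := by
  intro g h v w
  by_cases hg : g.IsSwap
  · obtain ⟨i, j, hij, rfl⟩ := hg
    rw [conj_swap, kappaReflL_swap _ _ _ _ hij, kappaReflL_swap _ _ _ _ (h.injective.ne hij),
      map_smul, rep_reflVec _ _ _ _ _ hij, reflForm_rep_inv]
  · rw [kappaReflL_of_not_isSwap _ _ _ _ hg,
      kappaReflL_of_not_isSwap _ _ _ _ (mt (isSwap_conj_iff g h).mp hg)]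
    simp

theorem isInvariant_kappaReflC (c : ℂ) :
    IsInvariant (doubledPermRep n) (Representation.trivial ℂ _ ℂ) (kappaReflC n c) := by
  intro g h v w
  rw [Representation.trivial_apply]
  by_cases hg : g.IsSwap
  · obtain ⟨i, j, hij, rfl⟩ := hg
    rw [conj_swap, kappaReflC_swap _ hij, kappaReflC_swap _ (h.injective.ne hij),
      reflForm_rep_inv]
  · rw [kappaReflC_of_not_isSwap _ hg,
      kappaReflC_of_not_isSwap _ (mt (isSwap_conj_iff g h).mp hg)]
    simp

theorem isInvariant_kappaTriC (a a' b b' : ℂ) :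
    IsInvariant (doubledPermRep n) (Representation.trivial ℂ _ ℂ) (kappaTriC n a a' b b') := by
  intro g h v w
  rw [Representation.trivial_apply]
  by_cases hg : g.IsThreeCycle
  · rw [kappaTriC_of_isThreeCycle _ _ _ _ hg,
      kappaTriC_of_isThreeCycle _ _ _ _ ((isThreeCycle_conj_iff g h).mpr hg)]
    symm
    rw [← Equiv.sum_comp h]
    refine Finset.sum_congr rfl fun p _ => ?_
    simp [ell, cx_rep, cy_rep]
  · rw [kappaTriC_of_not_isThreeCycle _ _ _ _ hg,
      kappaTriC_of_not_isThreeCycle _ _ _ _ (mt (isThreeCycle_conj_iff g h).mp hg)]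
    simp

theorem isInvariant_kappaOneC (α β : ℂ) :
    IsInvariant (doubledPermRep n) (Representation.trivial ℂ _ ℂ) (kappaOneC n α β) := by
  intro g h v w
  rw [Representation.trivial_apply]
  by_cases hg : g = 1
  · subst hg
    rw [mul_one, mul_inv_cancel, kappaOneC_one, altOfTable_oneTable, altOfTable_oneTable]
    simp only [cx_rep, cy_rep, inv_inv]
    rw [Equiv.sum_comp h (fun p => cx p v * cy p w - cy p v * cx p w),
      Equiv.sum_comp h (fun p => cx p v), Equiv.sum_comp h (fun p => cy p v),
      Equiv.sum_comp h (fun p => cx p w), Equiv.sum_comp h (fun p => cy p w)]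
  · rw [kappaOneC_of_ne_one _ _ hg, kappaOneC_of_ne_one _ _ (by simpa [conj_eq_one_iff] using hg)]
    simp

theorem IsInvariant.add {M : Type*} [AddCommGroup M] [Module ℂ M]
    {ρ : Representation ℂ (Equiv.Perm (Fin n)) (DoubledSpace n)}
    {τ : Representation ℂ (Equiv.Perm (Fin n)) M}
    {κ μ : TwoCochain (Equiv.Perm (Fin n)) (DoubledSpace n) M}
    (hκ : IsInvariant ρ τ κ) (hμ : IsInvariant ρ τ μ) : IsInvariant ρ τ (κ + μ) := by
  intro g h v w
  simp only [Pi.add_apply, AlternatingMap.add_apply, map_add, hκ g h v w, hμ g h v w]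

end Invariance

/-! ### The four equations suffice -/

section Sufficiency

variable {n : ℕ}

theorem second_obstruction_one {a a' b b' α β : ℂ}
    (h1 : α * a + β * (a + ((n : ℂ) - 2) * a') = 0)
    (h2 : α * a' + β * (2 * a + ((n : ℂ) - 3) * a') = 0)
    (h3 : α * b + β * (b + ((n : ℂ) - 2) * b') = 0)
    (h4 : α * b' + β * (2 * b + ((n : ℂ) - 3) * b') = 0)
    (g : Equiv.Perm (Fin n)) (u v w : DoubledSpace n) :
    kappaOneC n α β 1 ![u, kappaReflL n a a' b b' g ![v, w]] = 0 := by
  by_cases hg : g.IsSwap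
  · obtain ⟨i, j, hij, rfl⟩ := hg
    rw [kappaReflL_swap _ _ _ _ hij, alt_swap, AlternatingMap.map_vecCons_smul, alt_swap, kappaOneC_reflVec _ _ _ _ _ _ hij]
    simp [h1, h2, h3, h4]
  · rw [kappaReflL_of_not_isSwap _ _ _ _ hg]
    exact alt_apply_zero_right _ _

theorem isDrinfeldOrbifoldAlgebraMap_of_conditions {a a' b b' α β : ℂ} (c : ℂ)
    (h1 : α * a + β * (a + ((n : ℂ) - 2) * a') = 0)
    (h2 : α * a' + β * (2 * a + ((n : ℂ) - 3) * a') = 0)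
    (h3 : α * b + β * (b + ((n : ℂ) - 2) * b') = 0)
    (h4 : α * b' + β * (2 * b + ((n : ℂ) - 3) * b') = 0) :
    IsDrinfeldOrbifoldAlgebraMap (doubledPermRep n) (kappaReflL n a a' b b')
      (kappaTriC n a a' b b' + kappaReflC n c + kappaOneC n α β) where
  image_fixed g v w := by
    by_cases hg : g.IsSwap
    · obtain ⟨i, j, hij, rfl⟩ := hg
      rw [kappaReflL_swap _ _ _ _ hij, map_smul]
      congr 1
      refine ext_coord (fun p => ?_) (fun p => ?_)
      · simp only [rep_reflVec _ _ _ _ _ hij, Equiv.swap_apply_left, Equiv.swap_apply_right,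
          cx_reflVec _ _ _ _ hij, cx_reflVec _ _ _ _ hij.symm, or_comm]
      · simp only [rep_reflVec _ _ _ _ _ hij, Equiv.swap_apply_left, Equiv.swap_apply_right,
          cy_reflVec _ _ _ _ hij, cy_reflVec _ _ _ _ hij.symm, or_comm]
    · simp [kappaReflL_of_not_isSwap _ _ _ _ hg]
  invariant_linear := isInvariant_kappaReflL a a' b b'
  invariant_constant := ((isInvariant_kappaTriC a a' b b').add (isInvariant_kappaReflC c)).add
    (isInvariant_kappaOneC α β)
  mixed_jacobi g v₁ v₂ v₃ := by
    by_cases hg : g.IsSwap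
    · obtain ⟨i, j, hij, rfl⟩ := hg
      have h := altSum_reflForm i j v₁ v₂ v₃
      have h' := congrArg (fun v => SymmetricAlgebra.ι ℂ (DoubledSpace n) (reflVec a a' b b' i j) *
        SymmetricAlgebra.ι ℂ (DoubledSpace n) v) h
      simp only [altSum, map_add, map_smul, mul_add, mul_smul_comm, map_zero, mul_zero] at h'
      simp only [altSum, kappaReflL_swap _ _ _ _ hij, map_smul, smul_mul_assoc]
      exact h'
    · simp [altSum, kappaReflL_of_not_isSwap _ _ _ _ hg]
  first_obstruction g v₁ v₂ v₃ := by
    rw [first_obstruction_refl]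
    -- `κ^C_refl` and `κ^C_1` are cocycles, so adding them does not change the right side.
    have hr := isHomogeneous_kappaReflC c g v₁ v₂ v₃
    have ho : IsHomogeneous g (kappaOneC n α β g) := by
      by_cases hg : g = 1
      · subst hg; exact isHomogeneous_one _
      · rw [kappaOneC_of_ne_one _ _ hg]; intro _ _ _; simp [altSum]
    have ho := ho v₁ v₂ v₃
    congr 1
    simp only [altSum] at hr ho
    simp only [altSum, Pi.add_apply, AlternatingMap.add_apply, add_smul]
    rw [← add_zero (_ + _ + _ : DoubledSpace n), ← hr, ← add_zero (_ + _ : DoubledSpace n), ← ho]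
    abel
  second_obstruction g v₁ v₂ v₃ := by
    rw [second_obstruction_add]
    simp only [second_obstruction_one h1 h2 h3 h4, altSum, add_zero]

end Sufficiency

/-! ### The parameters and equations are forced -/

section Necessity

variable {n : ℕ}

theorem exists_perm_pair {i₀ j₀ i j : Fin n} (h₀ : i₀ ≠ j₀) (h : i ≠ j) :
    ∃ σ : Equiv.Perm (Fin n), σ i₀ = i ∧ σ j₀ = j := by
  have hne : i ≠ Equiv.swap i₀ i j₀ := fun e => h₀ <| (Equiv.swap i₀ i).injective <| by
    rw [← e, Equiv.swap_apply_left]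
  refine ⟨Equiv.swap (Equiv.swap i₀ i j₀) j * Equiv.swap i₀ i, ?_, ?_⟩
  · rw [Equiv.Perm.mul_apply, Equiv.swap_apply_left, Equiv.swap_apply_of_ne_of_ne hne h]
  · rw [Equiv.Perm.mul_apply, Equiv.swap_apply_left]

theorem exists_perm_triple {i₀ j₀ k₀ i j k : Fin n} (hij₀ : i₀ ≠ j₀) (hik₀ : i₀ ≠ k₀)
    (hjk₀ : j₀ ≠ k₀) (hij : i ≠ j) (hik : i ≠ k) (hjk : j ≠ k) :
    ∃ σ : Equiv.Perm (Fin n), σ i₀ = i ∧ σ j₀ = j ∧ σ k₀ = k := by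
  obtain ⟨σ, rfl, rfl⟩ := exists_perm_pair hij₀ hij
  refine ⟨Equiv.swap (σ k₀) k * σ, ?_, ?_, ?_⟩
  · rw [Equiv.Perm.mul_apply, Equiv.swap_apply_of_ne_of_ne (σ.injective.ne hik₀) hik]
  · rw [Equiv.Perm.mul_apply, Equiv.swap_apply_of_ne_of_ne (σ.injective.ne hjk₀) hjk]
  · rw [Equiv.Perm.mul_apply, Equiv.swap_apply_left]

theorem IsInvariant.apply_rep {M : Type*} [AddCommGroup M] [Module ℂ M]
    {τ : Representation ℂ (Equiv.Perm (Fin n)) M}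
    {κ : TwoCochain (Equiv.Perm (Fin n)) (DoubledSpace n) M}
    (hκ : IsInvariant (doubledPermRep n) τ κ) (g h : Equiv.Perm (Fin n)) (v w : DoubledSpace n) :
    κ (h * g * h⁻¹) ![doubledPermRep n h v, doubledPermRep n h w] = τ h (κ g ![v, w]) := by
  rw [← hκ g h]
  simp

theorem IsInvariant.swap_value {M : Type*} [AddCommGroup M] [Module ℂ M]
    {τ : Representation ℂ (Equiv.Perm (Fin n)) M}
    {κ : TwoCochain (Equiv.Perm (Fin n)) (DoubledSpace n) M}
    (hκ : IsInvariant (doubledPermRep n) τ κ) (h : Equiv.Perm (Fin n)) (i j : Fin n) :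
    κ (Equiv.swap (h i) (h j)) ![xyBasis n (Sum.inl (h i)), xyBasis n (Sum.inr (h i))] =
      τ h (κ (Equiv.swap i j) ![xyBasis n (Sum.inl i), xyBasis n (Sum.inr i)]) := by
  rw [← hκ.apply_rep, conj_swap, rep_x, rep_y]

/-- All transpositions are conjugate, so a single vector `U` determines the cochain. Being fixed by
`(i₀ j₀)` equates its coordinates at `i₀` and `j₀`; transporting `k₀` to an arbitrary third index
shows that the other coordinates agree. -/
theorem eq_kappaReflL {κL : TwoCochain (Equiv.Perm (Fin n)) (DoubledSpace n) (DoubledSpace n)}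
    {i₀ j₀ k₀ : Fin n} (hij₀ : i₀ ≠ j₀) (hik₀ : i₀ ≠ k₀) (hjk₀ : j₀ ≠ k₀)
    (hone : κL 1 = 0)
    (hfix : ∀ g v w, doubledPermRep n g (κL g ![v, w]) = κL g ![v, w])
    (hinv : IsInvariant (doubledPermRep n) (doubledPermRep n) κL)
    (hhom : ∀ (g : Equiv.Perm (Fin n)) (f : DoubledSpace n →ₗ[ℂ] ℂ),
      IsHomogeneous g (f.compAlternatingMap (κL g))) :
    ∃ a a' b b', κL = kappaReflL n a a' b b' := by
  set U := κL (Equiv.swap i₀ j₀) ![xyBasis n (Sum.inl i₀), xyBasis n (Sum.inr i₀)] with hU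
  have hUfix := hfix (Equiv.swap i₀ j₀) (xyBasis n (Sum.inl i₀)) (xyBasis n (Sum.inr i₀))
  rw [← hU] at hUfix
  have hUx : cx j₀ U = cx i₀ U := by
    have := congrArg (cx i₀) hUfix
    simpa using this
  have hUy : cy j₀ U = cy i₀ U := by
    have := congrArg (cy i₀) hUfix
    simpa using this
  have hval : ∀ i j, i ≠ j →
      κL (Equiv.swap i j) ![xyBasis n (Sum.inl i), xyBasis n (Sum.inr i)] =
        reflVec (cx i₀ U) (cx k₀ U) (cy i₀ U) (cy k₀ U) i j := by
    intro i j hij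
    have pair : ∃ σ : Equiv.Perm (Fin n), σ i₀ = i ∧ σ j₀ = j := exists_perm_pair hij₀ hij
    have coord : ∀ p, (∃ q, (cx p (κL (Equiv.swap i j)
        ![xyBasis n (Sum.inl i), xyBasis n (Sum.inr i)]) = cx q U ∧
        cy p (κL (Equiv.swap i j) ![xyBasis n (Sum.inl i), xyBasis n (Sum.inr i)]) = cy q U) ∧
        (p = i → q = i₀) ∧ (p = j → q = j₀) ∧ (p ≠ i → p ≠ j → q = k₀)) := by
      intro p
      obtain ⟨σ, hσi, hσj, hσp⟩ : ∃ σ : Equiv.Perm (Fin n), σ i₀ = i ∧ σ j₀ = j ∧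
          (p ≠ i → p ≠ j → σ k₀ = p) := by
        by_cases hp : p ≠ i ∧ p ≠ j
        · obtain ⟨σ, h1, h2, h3⟩ := exists_perm_triple hij₀ hik₀ hjk₀ hij hp.1.symm hp.2.symm
          exact ⟨σ, h1, h2, fun _ _ => h3⟩
        · obtain ⟨σ, h1, h2⟩ := pair
          exact ⟨σ, h1, h2, fun h3 h4 => absurd ⟨h3, h4⟩ hp⟩
      have hs := hinv.swap_value σ i₀ j₀
      rw [hσi, hσj] at hs
      refine ⟨σ⁻¹ p, ⟨?_, ?_⟩, ?_, ?_, ?_⟩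
      · rw [hs, cx_rep]
      · rw [hs, cy_rep]
      · rintro rfl; rw [Equiv.Perm.inv_eq_iff_eq, hσi]
      · rintro rfl; rw [Equiv.Perm.inv_eq_iff_eq, hσj]
      · intro h1 h2; rw [Equiv.Perm.inv_eq_iff_eq, hσp h1 h2]
    refine ext_coord (fun p => ?_) (fun p => ?_)
    · obtain ⟨q, ⟨hx, -⟩, h1, h2, h3⟩ := coord p
      rw [hx, cx_reflVec _ _ _ _ hij]
      by_cases hpi : p = i
      · rw [h1 hpi, if_pos (Or.inl hpi)]
      · by_cases hpj : p = j
        · rw [h2 hpj, if_pos (Or.inr hpj), hUx]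
        · rw [h3 hpi hpj, if_neg (by tauto)]
    · obtain ⟨q, ⟨-, hy⟩, h1, h2, h3⟩ := coord p
      rw [hy, cy_reflVec _ _ _ _ hij]
      by_cases hpi : p = i
      · rw [h1 hpi, if_pos (Or.inl hpi)]
      · by_cases hpj : p = j
        · rw [h2 hpj, if_pos (Or.inr hpj), hUy]
        · rw [h3 hpi hpj, if_neg (by tauto)]
  refine ⟨cx i₀ U, cx k₀ U, cy i₀ U, cy k₀ U, ?_⟩
  funext g
  refine alt_ext fun v w => ?_
  by_cases hs : g.IsSwap
  · obtain ⟨i, j, hij, rfl⟩ := hs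
    rw [kappaReflL_swap _ _ _ _ hij, ← hval i j hij]
    refine ext_coord (fun p => ?_) (fun p => ?_)
    · simpa using (hhom _ (cx p)).eq_reflForm_swap hij v w
    · simpa using (hhom _ (cy p)).eq_reflForm_swap hij v w
  · rw [kappaReflL_of_not_isSwap _ _ _ _ hs]
    by_cases hg : g = 1
    · rw [hg, hone]
    · refine ext_coord (fun p => ?_) (fun p => ?_)
      · simpa using congrArg (fun c => c ![v, w]) ((hhom g (cx p)).eq_zero hg hs)
      · simpa using congrArg (fun c => c ![v, w]) ((hhom g (cy p)).eq_zero hg hs)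

theorem eq_kappaOneC_of_isInvariant {κC : TwoCochain (Equiv.Perm (Fin n)) (DoubledSpace n) ℂ}
    {i₀ j₀ : Fin n} (hij₀ : i₀ ≠ j₀)
    (hinv : IsInvariant (doubledPermRep n) (Representation.trivial ℂ _ ℂ) κC) :
    ∃ α β, κC 1 = kappaOneC n α β 1 := by
  have hval : ∀ (h : Equiv.Perm (Fin n)) v w,
      κC 1 ![doubledPermRep n h v, doubledPermRep n h w] = κC 1 ![v, w] := by
    intro h v w
    have := hinv.apply_rep 1 h v w
    rwa [mul_one, mul_inv_cancel, Representation.trivial_apply] at this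
  have half : ∀ z : ℂ, z = -z → z = 0 := fun z hz => by linear_combination hz / 2
  -- The transposition `(i j)` exchanges the two arguments, so invariance makes the value equal to
  -- its own negative.
  have hsymm : ∀ (e : Fin n → DoubledSpace n), (∀ h i, doubledPermRep n h (e i) = e (h i)) →
      ∀ i j, κC 1 ![e i, e j] = 0 := by
    intro e he i j
    refine half _ ?_
    rw [← alt_swap, ← hval (Equiv.swap i j), he, he, Equiv.swap_apply_left, Equiv.swap_apply_right]
  have hxy : ∀ i j, κC 1 ![xyBasis n (Sum.inl i), xyBasis n (Sum.inr j)] =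
      if i = j then κC 1 ![xyBasis n (Sum.inl i₀), xyBasis n (Sum.inr i₀)]
      else κC 1 ![xyBasis n (Sum.inl i₀), xyBasis n (Sum.inr j₀)] := by
    intro i j
    split_ifs with h
    · subst h
      rw [← hval (Equiv.swap i i₀), rep_x, rep_y, Equiv.swap_apply_left]
    · obtain ⟨σ, rfl, rfl⟩ := exists_perm_pair hij₀ h
      rw [← rep_x, ← rep_y, hval]
  refine ⟨κC 1 ![xyBasis n (Sum.inl i₀), xyBasis n (Sum.inr i₀)],
    κC 1 ![xyBasis n (Sum.inl i₀), xyBasis n (Sum.inr j₀)], ?_⟩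
  rw [kappaOneC_one]
  refine eq_altOfTable _ _ _ _ ?_
  rintro (i | i) (j | j)
  · exact hsymm (fun i => xyBasis n (Sum.inl i)) rep_x i j
  · exact hxy i j
  · rw [alt_swap, hxy]; rfl
  · exact hsymm (fun i => xyBasis n (Sum.inr i)) rep_y i j

theorem eq_constant_part {κC : TwoCochain (Equiv.Perm (Fin n)) (DoubledSpace n) ℂ}
    {i₀ j₀ : Fin n} (hij₀ : i₀ ≠ j₀) (a a' b b' : ℂ)
    (hinv : IsInvariant (doubledPermRep n) (Representation.trivial ℂ _ ℂ) κC)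
    (hhom : ∀ g, IsHomogeneous g (κC g - kappaTriC n a a' b b' g)) :
    ∃ c α β, κC = kappaTriC n a a' b b' + kappaReflC n c + kappaOneC n α β := by
  obtain ⟨α, β, hone⟩ := eq_kappaOneC_of_isInvariant hij₀ hinv
  refine ⟨κC (Equiv.swap i₀ j₀) ![xyBasis n (Sum.inl i₀), xyBasis n (Sum.inr i₀)], α, β, ?_⟩
  have not_one : ¬ (1 : Equiv.Perm (Fin n)).IsSwap := fun h => by
    simpa using h.sign_eq
  funext g
  rw [Pi.add_apply, Pi.add_apply]
  by_cases hg : g = 1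
  · subst hg
    rw [kappaReflC_of_not_isSwap _ not_one,
      kappaTriC_of_not_isThreeCycle _ _ _ _ (fun h => h.ne_one rfl), hone, zero_add, zero_add]
  rw [kappaOneC_of_ne_one _ _ hg, add_zero]
  by_cases hs : g.IsSwap
  · obtain ⟨i, j, hij, rfl⟩ := hs
    have htri : kappaTriC n a a' b b' (Equiv.swap i j) = 0 :=
      kappaTriC_of_not_isThreeCycle _ _ _ _ fun h => by
        have := h.sign
        rw [Equiv.Perm.sign_swap hij] at this
        exact absurd this (by decide)
    have h := hhom (Equiv.swap i j)
    rw [htri, sub_zero] at h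
    rw [htri, zero_add]
    refine alt_ext fun v w => ?_
    rw [kappaReflC_swap _ hij, h.eq_reflForm_swap hij]
    obtain ⟨σ, rfl, rfl⟩ := exists_perm_pair hij₀ hij
    rw [hinv.swap_value, Representation.trivial_apply]
  · rw [kappaReflC_of_not_isSwap _ hs, add_zero]
    exact sub_eq_zero.mp ((hhom g).eq_zero hg hs)

/-- At `v, x_i, y_i` with `v` fixed by `(i j)`, only one term survives, because `reflForm i j` kills
`v`. The choices `x_k, y_k, x_i + x_j, y_i + y_j` for `v` give one equation each. -/
theorem conditions_of_second_obstruction {i j k : Fin n} (hij : i ≠ j) (hik : i ≠ k)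
    (hjk : j ≠ k) {a a' b b' α β : ℂ}
    (h : ∀ v₁ v₂ v₃ : DoubledSpace n, altSum (fun u₁ u₂ u₃ => kappaOneC n α β 1
      ![u₁ + doubledPermRep n (Equiv.swap i j) u₁,
        kappaReflL n a a' b b' (Equiv.swap i j) ![u₂, u₃]]) v₁ v₂ v₃ = 0) :
    α * a + β * (a + ((n : ℂ) - 2) * a') = 0 ∧
      α * a' + β * (2 * a + ((n : ℂ) - 3) * a') = 0 ∧
      α * b + β * (b + ((n : ℂ) - 2) * b') = 0 ∧
      α * b' + β * (2 * b + ((n : ℂ) - 3) * b') = 0 := by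
  have key : ∀ v, cx i v = cx j v → cy i v = cy j v →
      kappaOneC n α β 1 ![v + doubledPermRep n (Equiv.swap i j) v, reflVec a a' b b' i j] = 0 := by
    intro v hx hy
    have := h v (xyBasis n (Sum.inl i)) (xyBasis n (Sum.inr i))
    simpa [altSum, kappaReflL_swap _ _ _ _ hij, reflForm, hx, hy, hij, alt_apply_zero_right]
      using this
  simp only [kappaOneC_reflVec _ _ _ _ _ _ hij, map_add, cx_rep, cy_rep, Equiv.swap_inv] at key
  have kx := key (xyBasis n (Sum.inl k)) (by simp [hik.symm, hjk.symm]) (by simp)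
  have ky := key (xyBasis n (Sum.inr k)) (by simp) (by simp [hik.symm, hjk.symm])
  have ix := key (xyBasis n (Sum.inl i) + xyBasis n (Sum.inl j)) (by simp [hij, hij.symm])
    (by simp)
  have iy := key (xyBasis n (Sum.inr i) + xyBasis n (Sum.inr j)) (by simp)
    (by simp [hij, hij.symm])
  have hk : ∀ p, k = Equiv.swap i j p ↔ k = p := fun p => by
    rw [← Equiv.swap_apply_eq_iff, Equiv.swap_apply_of_ne_of_ne hik.symm hjk.symm]
  have hi : ∀ p, i = Equiv.swap i j p ↔ j = p := fun p => by
    rw [← Equiv.swap_apply_eq_iff, Equiv.swap_apply_left]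
  have hj : ∀ p, j = Equiv.swap i j p ↔ i = p := fun p => by
    rw [← Equiv.swap_apply_eq_iff, Equiv.swap_apply_right]
  simp only [map_add, cx_x, cx_y, cy_x, cy_y, hk, hi, hj, add_mul, ite_mul, one_mul, zero_mul,
    Finset.sum_add_distrib, Finset.sum_ite_eq, Finset.mem_univ, if_true, add_zero,
    Finset.sum_const_zero, sub_zero, zero_sub, hik.symm, hjk.symm, hij, hij.symm, or_self,
    true_or, or_true, if_false] at kx ky ix iy
  refine ⟨?_, ?_, ?_, ?_⟩
  -- Since `v + g v = 2 v`, every equation carries a factor `2`; the sums over `i` and `j` carry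
  -- another `2`.
  · linear_combination -iy / 4
  · linear_combination -ky / 2
  · linear_combination ix / 4
  · linear_combination kx / 2

end Necessity

end

end DrinfeldOrbifold

/-- Classification of the Drinfeld orbifold algebra maps for the doubled permutation representation
whose linear part is supported only off the identity. -/
theorem mainTheorem2 (n : ℕ) (hn : 4 ≤ n) :
    (∀ (κL : DrinfeldOrbifold.TwoCochain (Equiv.Perm (Fin n)) (DrinfeldOrbifold.DoubledSpace n)
          (DrinfeldOrbifold.DoubledSpace n))
        (κC : DrinfeldOrbifold.TwoCochain (Equiv.Perm (Fin n)) (DrinfeldOrbifold.DoubledSpace n) ℂ),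
      (DrinfeldOrbifold.IsDrinfeldOrbifoldAlgebraMap (DrinfeldOrbifold.doubledPermRep n) κL κC ∧
          DrinfeldOrbifold.SupportedOnlyOff κL {1}) ↔
        ∃ a a' b b' c α β : ℂ,
          (α * a + β * (a + ((n : ℂ) - 2) * a') = 0 ∧
            α * a' + β * (2 * a + ((n : ℂ) - 3) * a') = 0 ∧
            α * b + β * (b + ((n : ℂ) - 2) * b') = 0 ∧
            α * b' + β * (2 * b + ((n : ℂ) - 3) * b') = 0) ∧
          κL = DrinfeldOrbifold.kappaReflL n a a' b b' ∧
          κC = DrinfeldOrbifold.kappaTriC n a a' b b' + DrinfeldOrbifold.kappaReflC n c +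
            DrinfeldOrbifold.kappaOneC n α β) ∧
    (∀ a a' b b' c : ℂ,
      DrinfeldOrbifold.IsDrinfeldOrbifoldAlgebraMap (DrinfeldOrbifold.doubledPermRep n)
        (DrinfeldOrbifold.kappaReflL n a a' b b')
        (DrinfeldOrbifold.kappaTriC n a a' b b' + DrinfeldOrbifold.kappaReflC n c)) := by
  open DrinfeldOrbifold in
  refine ⟨fun κL κC => ⟨?_, ?_⟩, fun a a' b b' c => ?_⟩
  · rintro ⟨H, hoff⟩
    let i : Fin n := ⟨0, by omega⟩
    let j : Fin n := ⟨1, by omega⟩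
    let k : Fin n := ⟨2, by omega⟩
    have hij : i ≠ j := by simp [i, j]
    have hik : i ≠ k := by simp [i, k]
    have hjk : j ≠ k := by simp [j, k]
    obtain ⟨a, a', b, b', rfl⟩ := eq_kappaReflL hij hik hjk (hoff 1 rfl) H.image_fixed
      H.invariant_linear fun g => isHomogeneous_coord (H.image_fixed g) (H.mixed_jacobi g)
    -- The first obstruction has the same left side for `κC` and `κ^C_tri`, so their difference is a
    -- cocycle.
    have hhom : ∀ g, IsHomogeneous g (κC g - kappaTriC n a a' b b' g) := by
      intro g v₁ v₂ v₃
      have h := H.first_obstruction g v₁ v₂ v₃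
      rw [first_obstruction_refl] at h
      have h := smul_right_injective _ (two_ne_zero : (2 : ℂ) ≠ 0) h
      simp only [altSum] at h
      simp only [altSum, AlternatingMap.sub_apply, sub_smul]
      rw [← sub_eq_zero] at h
      rw [← neg_eq_zero, ← h]
      abel
    obtain ⟨c, α, β, rfl⟩ := eq_constant_part hij a a' b b' H.invariant_constant hhom
    refine ⟨a, a', b, b', c, α, β, conditions_of_second_obstruction hij hik hjk ?_, rfl, rfl⟩
    intro v₁ v₂ v₃
    rw [← second_obstruction_add a a' b b' c]
    exact H.second_obstruction _ _ _ _
  · rintro ⟨a, a', b, b', c, α, β, ⟨h1, h2, h3, h4⟩, rfl, rfl⟩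
    refine ⟨isDrinfeldOrbifoldAlgebraMap_of_conditions c h1 h2 h3 h4, ?_⟩
    rintro g rfl
    exact kappaReflL_of_not_isSwap _ _ _ _ fun h => by simpa using h.sign_eq
  · have h := isDrinfeldOrbifoldAlgebraMap_of_conditions (n := n) (a := a) (a' := a') (b := b)
      (b' := b') (α := 0) (β := 0) c (by ring) (by ring) (by ring) (by ring)
    have h0 : kappaOneC n 0 0 = 0 := by
      funext g
      by_cases hg : g = 1
      · subst hg
        refine alt_ext fun v w => ?_
        rw [kappaOneC_one, altOfTable_oneTable]
        simp
      · exact kappaOneC_of_ne_one _ _ hg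
    rwa [h0, add_zero] at h
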